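/- **Theorem 4.2.** Fix $n\ge 0$. Let $\mathrm{Cob}(n)$ be the following category. Its objects are formally $q$-graded planar Temperley–Lieb diagrams $q^j a$ ($j\in\mathbb Z$) in a rectangle, with $n$ end points on the top and $n$ on the bottom side (closed circles allowed). Its morphisms $q^i a\to q^j b$ are the $\mathbb Z[\alpha]$-linear combinations of dotted orientable cobordisms from $a$ to $b$ in (rectangle)$\,\times[0,1]$, with identity boundary on the vertical sides, modulo isotopy (in the presence of the following relations it is equivalent to identify cobordisms that are homeomorphic relative to the boundary) and the local relations: a sphere with $0,1,2,3$ dots equals $0,1,0,\alpha$ respectively, and neck cutting (a cylinder is the sum of the two ways of replacing it by two disks of which one carries a dot). The degree of a cobordism $C\colon q^ia\to q^jb$ is $\chi(C)-n+j-i$, where every dot contributes $-2$; and $\deg\alpha=-4$. Write $a\otimes b$ for the diagram $a$ glued on top of $b$. Let $\mathrm{Kom}(n)$ consist of the complexes $(P_k,d_k\colon P_k\to P_{k+1})_{k\in\mathbb Z}$ over the category $\mathrm{Mat}(\mathrm{Cob}(n))$ of finite formal direct sums and matrices that vanish in all sufficiently negative homological degrees. Let $1$ be the identity diagram and let $e_i$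 ($0<i<n$) be the standard Temperley–Lieb generators. A complex $P\in\mathrm{Kom}(n)$ is a *universal projector* if 1. $P_k=0$ for $k<0$; for $k>0$ all summands of $P_k$ have $q$-degree $\ge 0$; and each $d_k$ is a matrix of morphisms of degree $0$; 2. $P_0\cong 1$ by an isomorphism that, like its inverse, has degree $0$; and for $k>0$ there is no object $D$ such that $P_k\cong 1\oplus D$ (by an isomorphism of any degree); 3. for all $0<i<n$ the complexes $P\otimes e_i$ and $e_i\otimes P$ are contractible, by homotopies of degree $0$. For $n=2$ write $e=e_1$, and let $t,b\colon e\to e$ be the identity cobordism with one dot on the sheet over the top arc, respectively over the bottom arc, of $e$. Let $P_2$ be given by $$(P_2)_k=\begin{cases}0&k<0\\ q^0\,1&k=0\\ q^{2k-1}e&k>0\end{cases}\qquad d_k=\begin{cases}\text{the saddle }1\to q\,e&k=0\\ t-b\colon q^{2k-1}e\to q^{2k+1}e&k>0\text{ odd}\\ t+b\colon q^{2k-1}e\to q^{2k+1}e&k>0\text{ even.}\end{cases}$$ Then $d_{k+1}\circ d_k=0$ for all $k$, and the complex $P_2\in\mathrm{Kom}(2)$ is a universal projector. -/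

import Mathlib

open CategoryTheory CategoryTheory.Limits

noncomputable section

namespace BarNatan

/-! ### Planar diagrams

A planar diagram is cut by horizontal lines, from top to bottom, into elementary layers. -/

/-- An elementary layer, read from top to bottom: `cup i` is an arc `∪` that joins the strands
`i` and `i + 1` coming from above, and `cap i` is an arc `∩` that starts two new strands, in
positions `i` and `i + 1` below. All other strands go straight down (positions count from `0`). -/
inductive Layer : Type
  | cup (i : ℕ)
  | cap (i : ℕ)
  deriving DecidableEq

/-- The number of strands that leave a word of layers at the bottom, if `m` enter at the top. -/
def width : ℕ → List Layer → ℕ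
  | m, [] => m
  | m, Layer.cup _ :: w => width (m - 2) w
  | m, Layer.cap _ :: w => width (m + 2) w

/-- The word of layers is a planar diagram with `m` end points on top and `k` at the bottom. -/
def IsTangle : ℕ → ℕ → List Layer → Prop
  | m, k, [] => m = k
  | m, k, Layer.cup i :: w => i + 2 ≤ m ∧ IsTangle (m - 2) k w
  | m, k, Layer.cap i :: w => i ≤ m ∧ IsTangle (m + 2) k w

theorem IsTangle.append {m k l : ℕ} {v w : List Layer} (hv : IsTangle m k v)
    (hw : IsTangle k l w) : IsTangle m l (v ++ w) := by
  induction v generalizing m with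
  | nil => cases hv; exact hw
  | cons L v ih => cases L <;> exact ⟨hv.1, ih hv.2⟩

theorem IsTangle.width_eq {m k : ℕ} {v : List Layer} (hv : IsTangle m k v) : width m v = k := by
  induction v generalizing m with
  | nil => exact hv
  | cons L v ih => cases L <;> exact ih hv.2

theorem width_append (m : ℕ) (v w : List Layer) : width m (v ++ w) = width (width m v) w := by
  induction v generalizing m with
  | nil => rfl
  | cons L v ih => cases L <;> exact ih _

/-- Temperley-Lieb diagrams in a rectangle with `n` end points on top and `n` at the bottom;
closed circles are allowed. -/
structure Diagram (n : ℕ) : Type where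
  word : List Layer
  isTangle : IsTangle n n word

variable {n : ℕ}

/-- The point `(l, j)` is the `j`-th strand on the `l`-th horizontal line of the diagram. -/
abbrev Diagram.Pt (a : Diagram n) : Type :=
  {z : ℕ × ℕ // z.1 ≤ a.word.length ∧ z.2 < width n (a.word.take z.1)}

/-- The two points are joined by an arc in the layer `L` between the lines `l` and `l + 1`. -/
inductive Layer.Joins (l : ℕ) : Layer → ℕ × ℕ → ℕ × ℕ → Prop
  | cup_left (i j : ℕ) (h : j < i) : Joins l (cup i) (l, j) (l + 1, j)
  | cup_turn (i : ℕ) : Joins l (cup i) (l, i) (l, i + 1)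
  | cup_right (i j : ℕ) (h : i ≤ j) : Joins l (cup i) (l, j + 2) (l + 1, j)
  | cap_left (i j : ℕ) (h : j < i) : Joins l (cap i) (l, j) (l + 1, j)
  | cap_turn (i : ℕ) : Joins l (cap i) (l + 1, i) (l + 1, i + 1)
  | cap_right (i j : ℕ) (h : i ≤ j) : Joins l (cap i) (l, j) (l + 1, j + 2)

/-- The two points of the diagram are joined by an arc within one layer. -/
def Diagram.Joined (a : Diagram n) (p q : a.Pt) : Prop :=
  ∃ (l : ℕ) (L : Layer), a.word[l]? = some L ∧ L.Joins l p.1 q.1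

/-! ### Cobordisms

A dotted cobordism in (rectangle) × [0,1] is given by a movie: a finite sequence of planar
diagrams, the horizontal slices, in which each is obtained from the one before by one elementary
change. -/

/-- The generating planar isotopies: straightening a zigzag, and exchanging the heights of two
neighbouring layers that do not meet. -/
inductive PlanarMove : List Layer → List Layer → Prop
  | zigzag (i : ℕ) : PlanarMove [.cap i, .cup (i + 1)] []
  | zagzig (i : ℕ) : PlanarMove [.cap (i + 1), .cup i] []
  | cup_cup (i j : ℕ) (h : i ≤ j) : PlanarMove [.cup i, .cup j] [.cup (j + 2), .cup i]
  | cap_cap (i j : ℕ) (h : i ≤ j) : PlanarMove [.cap i, .cap (j + 2)] [.cap j, .cap i]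
  | cup_cap (i j : ℕ) (h : j ≤ i) : PlanarMove [.cup i, .cap j] [.cap j, .cup (i + 2)]
  | cup_cap' (i j : ℕ) (h : i ≤ j) : PlanarMove [.cup i, .cap j] [.cap (j + 2), .cup i]

/-- An elementary change of a few consecutive layers: a planar isotopy, the birth or
death of a small circle, a saddle between two neighbouring vertical
strands and its inverse, or a dot on the `j`-th strand. -/
inductive Event : List Layer → List Layer → Type
  | isotopy {x y : List Layer} (h : PlanarMove x y ∨ PlanarMove y x) : Event x y
  | birth (i : ℕ) : Event [] [.cap i, .cup i]
  | death (i : ℕ) : Event [.cap i, .cup i] []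
  | saddle (i : ℕ) : Event [] [.cup i, .cap i]
  | unsaddle (i : ℕ) : Event [.cup i, .cap i] []
  | dot (j : ℕ) : Event [] []

namespace Event

variable {x y : List Layer}

/-- The number of disks minus the number of bands that the event attaches to the surface. -/
def chi : Event x y → ℤ
  | isotopy _ => 0
  | birth _ => 1
  | death _ => 1
  | saddle _ => -1
  | unsaddle _ => -1
  | dot _ => 0

/-- The number of dots of the event. -/
def dots : Event x y → ℕ
  | dot _ => 1
  | _ => 0

/-- A point (line relative to the top of `x` or `y`, strand) of the diagram before (`inl`) or after
(`inr`) the event that lies on the component of the surface where the event takes place;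
it plays no role for an isotopy. -/
def site : Event x y → (ℕ × ℕ) ⊕ (ℕ × ℕ)
  | isotopy _ => .inl (0, 0)
  | birth i => .inr (1, i)
  | death i => .inl (1, i)
  | saddle i => .inl (0, i)
  | unsaddle i => .inr (0, i)
  | dot j => .inl (0, j)

/-- A dot has to lie on one of the `m` strands. -/
def Valid (m : ℕ) : Event x y → Prop
  | dot j => j < m
  | _ => True

end Event

/-- A step of a movie: the event takes place in the slab of layers between `u` and `v`, and the
rest of the surface is a product. -/
structure Step (a b : Diagram n) : Type where
  u : List Layer
  v : List Layer
  x : List Layer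
  y : List Layer
  event : Event x y
  src : a.word = u ++ x ++ v
  tgt : b.word = u ++ y ++ v
  valid : event.Valid (width n u)

namespace Step

variable {a b : Diagram n}

/-- A point before and a point after the step that lie on the same vertical segment of the surface,
outside of the interior of the slab. -/
def Matches (s : Step a b) (p : a.Pt) (q : b.Pt) : Prop :=
  p.1.2 = q.1.2 ∧
    ((p.1.1 = q.1.1 ∧ p.1.1 ≤ s.u.length) ∨
      ∃ r : ℕ, p.1.1 = s.u.length + s.x.length + r ∧ q.1.1 = s.u.length + s.y.length + r)

/-- The event of the step takes place on the part of the surface that contains the points `A`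
before and the points `B` after the step. -/
def Meets (s : Step a b) (A : a.Pt → Prop) (B : b.Pt → Prop) : Prop :=
  match s.event.site with
  | .inl z => ∃ p : a.Pt, p.1 = (s.u.length + z.1, z.2) ∧ A p
  | .inr z => ∃ q : b.Pt, q.1 = (s.u.length + z.1, z.2) ∧ B q

/-- Put the diagram `d` on top. -/
def glueTop (d : Diagram n) {a' b' : Diagram n} (ha : a'.word = d.word ++ a.word)
    (hb : b'.word = d.word ++ b.word) (s : Step a b) : Step a' b' where
  u := d.word ++ s.u
  v := s.v
  x := s.x
  y := s.y
  event := s.event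
  src := by rw [ha, s.src]; simp
  tgt := by rw [hb, s.tgt]; simp
  valid := by rw [width_append, d.isTangle.width_eq]; exact s.valid

/-- Put the diagram `d` below. -/
def glueBot (d : Diagram n) {a' b' : Diagram n} (ha : a'.word = a.word ++ d.word)
    (hb : b'.word = b.word ++ d.word) (s : Step a b) : Step a' b' where
  u := s.u
  v := s.v ++ d.word
  x := s.x
  y := s.y
  event := s.event
  src := by rw [ha, s.src]; simp
  tgt := by rw [hb, s.tgt]; simp
  valid := s.valid

end Step

/-- Dotted cobordisms from `a` to `b`, presented as movies. -/
inductive Movie (a : Diagram n) : Diagram n → Type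
  | nil : Movie a a
  | snoc {b c : Diagram n} (m : Movie a b) (s : Step b c) : Movie a c

namespace Movie

variable {a : Diagram n}

/-- Composition of cobordisms. -/
def comp {b : Diagram n} (m : Movie a b) : {c : Diagram n} → Movie b c → Movie a c
  | _, nil => m
  | _, snoc m' s => snoc (comp m m') s

theorem nil_comp {b : Diagram n} (m : Movie a b) : comp nil m = m := by
  induction m with
  | nil => rfl
  | snoc m s ih => simp only [comp, ih]

theorem comp_assoc {b c d : Diagram n} (m₁ : Movie a b) (m₂ : Movie b c) (m₃ : Movie c d) :
    comp (comp m₁ m₂) m₃ = comp m₁ (comp m₂ m₃) := by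
  induction m₃ with
  | nil => rfl
  | snoc m s ih => simp only [comp, ih]

/-- The movie with one step. -/
def ofStep {b : Diagram n} (s : Step a b) : Movie a b := snoc nil s

/-- The points of the surface swept out by a movie: the points of all its slices. -/
def Pt : {b : Diagram n} → Movie a b → Type
  | _, nil => a.Pt
  | c, snoc m _ => Pt m ⊕ c.Pt

/-- The points of the first slice. -/
def first : {b : Diagram n} → (m : Movie a b) → a.Pt → m.Pt
  | _, nil, p => p
  | _, snoc m _, p => Sum.inl (first m p)

/-- The points of the last slice. -/
def last : {b : Diagram n} → (m : Movie a b) → b.Pt → m.Pt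
  | _, nil, p => p
  | _, snoc _ _, p => Sum.inr p

/-- Two points of the surface are joined within a slice, or between two consecutive slices. -/
def Joined : {b : Diagram n} → (m : Movie a b) → m.Pt → m.Pt → Prop
  | _, nil => a.Joined
  | c, snoc m s => fun (p q : m.Pt ⊕ c.Pt) =>
      match p, q with
      | .inl p, .inl q => Joined m p q
      | .inl p, .inr q => ∃ r, last m r = p ∧ s.Matches r q
      | .inr _, .inl _ => False
      | .inr p, .inr q => c.Joined p q

/-- The connected components of the surface. -/
def Component {b : Diagram n} (m : Movie a b) : Type := Quot m.Joined

open Classical in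
/-- The relative Euler characteristic of the part of the surface that contains the points `S`:
the Euler characteristic minus that of the intersection with the first slice. -/
def chi : {b : Diagram n} → (m : Movie a b) → (m.Pt → Prop) → ℤ
  | _, nil, _ => 0
  | _, snoc m s, S =>
      chi m (fun p => S (Sum.inl p)) +
        if s.Meets (fun p => S (Sum.inl (last m p))) (fun q => S (Sum.inr q)) then s.event.chi else 0

open Classical in
/-- The number of dots on the part of the surface that contains the points `S`. -/
def dots : {b : Diagram n} → (m : Movie a b) → (m.Pt → Prop) → ℕ
  | _, nil, _ => 0
  | _, snoc m s, S =>
      dots m (fun p => S (Sum.inl p)) +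
        if s.Meets (fun p => S (Sum.inl (last m p))) (fun q => S (Sum.inr q)) then s.event.dots else 0

/-- Two dotted cobordisms with the same boundary are equivalent if there is a bijection between
their components that is compatible with the boundary and preserves the Euler characteristic
(hence the genus) and the number of dots; by the classification of surfaces this says that they
are homeomorphic relative to the boundary, as abstract dotted surfaces. Isotopic cobordisms are
equivalent in this sense, and cobordisms that are equivalent in this sense become equal
when neck cutting and the sphere relations are imposed on isotopy classes. -/
def Equivalent {b : Diagram n} (m m' : Movie a b) : Prop :=
  ∃ φ : m.Component ≃ m'.Component,
    (∀ p : a.Pt, φ (Quot.mk _ (m.first p)) = Quot.mk _ (m'.first p)) ∧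
    (∀ q : b.Pt, φ (Quot.mk _ (m.last q)) = Quot.mk _ (m'.last q)) ∧
    (∀ c : m.Component, m.chi (fun p => Quot.mk _ p = c) = m'.chi (fun p => Quot.mk _ p = φ c)) ∧
    (∀ c : m.Component, m.dots (fun p => Quot.mk _ p = c) = m'.dots (fun p => Quot.mk _ p = φ c))

/-- The topological degree `χ - n` of a cobordism, where a dot counts `-2`. (The first slice
contributes its `n` arcs, of Euler characteristic `1` each, to `χ`.) -/
def degree : {b : Diagram n} → Movie a b → ℤ
  | _, nil => 0
  | _, snoc m s => degree m + s.event.chi - 2 * (s.event.dots : ℤ)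

end Movie

namespace Diagram

/-- The diagram `a ⊗ b`: `a` on top of `b`. -/
def tensor (a b : Diagram n) : Diagram n := ⟨a.word ++ b.word, a.isTangle.append b.isTangle⟩

end Diagram

namespace Movie

variable {a : Diagram n}

/-- Glue the identity cobordism of `d` on top. -/
def glueTop (d : Diagram n) : {b : Diagram n} → Movie a b → Movie (d.tensor a) (d.tensor b)
  | _, nil => nil
  | _, snoc m s => snoc (glueTop d m) (s.glueTop d rfl rfl)

/-- Glue the identity cobordism of `d` below. -/
def glueBot (d : Diagram n) : {b : Diagram n} → Movie a b → Movie (a.tensor d) (b.tensor d)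
  | _, nil => nil
  | _, snoc m s => snoc (glueBot d m) (s.glueBot d rfl rfl)

theorem glueTop_comp (d : Diagram n) {b c : Diagram n} (m : Movie a b) (m' : Movie b c) :
    glueTop d (comp m m') = comp (glueTop d m) (glueTop d m') := by
  induction m' with
  | nil => rfl
  | snoc m s ih => simp only [comp, glueTop, ih]

theorem glueBot_comp (d : Diagram n) {b c : Diagram n} (m : Movie a b) (m' : Movie b c) :
    glueBot d (comp m m') = comp (glueBot d m) (glueBot d m') := by
  induction m' with
  | nil => rfl
  | snoc m s ih => simp only [comp, glueBot, ih]

end Movie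

/-! ### The category `Cob n` -/

/-- The formally `q`-graded diagram `q ^ deg` `diagram`. -/
structure GradedDiagram (n : ℕ) : Type where
  diagram : Diagram n
  deg : ℤ

instance (n : ℕ) : Category (GradedDiagram n) where
  Hom X Y := Movie X.diagram Y.diagram
  id _ := Movie.nil
  comp m m' := Movie.comp m m'
  id_comp m := Movie.nil_comp m
  comp_id _ := rfl
  assoc m₁ m₂ m₃ := Movie.comp_assoc m₁ m₂ m₃

/-- The graded diagram `X` glued on top. -/
def gradedTop (X : GradedDiagram n) : GradedDiagram n ⥤ GradedDiagram n where
  obj Y := ⟨X.diagram.tensor Y.diagram, X.deg + Y.deg⟩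
  map m := Movie.glueTop X.diagram m
  map_id _ := rfl
  map_comp m m' := Movie.glueTop_comp X.diagram m m'

/-- The graded diagram `X` glued below. -/
def gradedBot (X : GradedDiagram n) : GradedDiagram n ⥤ GradedDiagram n where
  obj Y := ⟨Y.diagram.tensor X.diagram, Y.deg + X.deg⟩
  map m := Movie.glueBot X.diagram m
  map_id _ := rfl
  map_comp m m' := Movie.glueBot_comp X.diagram m m'

/-- The base ring `ℤ[α]`. -/
abbrev R : Type := Polynomial ℤ

/-- The parameter `α`. -/
abbrev alpha : R := Polynomial.X

/-- Formal `ℤ[α]`-linear combinations of movies. -/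
abbrev PreCob (n : ℕ) : Type := Free R (GradedDiagram n)

/-- A cobordism as a morphism between two graded diagrams. -/
def lin {a b : Diagram n} (p q : ℤ) (m : Movie a b) :
    (Free.of R (⟨a, p⟩ : GradedDiagram n) ⟶ Free.of R (⟨b, q⟩ : GradedDiagram n)) :=
  (Free.embedding R (GradedDiagram n)).map (X := ⟨a, p⟩) (Y := ⟨b, q⟩) m

/-- The linear extension of `gradedTop`. -/
def preTop (X : GradedDiagram n) : PreCob n ⥤ PreCob n :=
  Free.lift R (gradedTop X ⋙ Free.embedding R (GradedDiagram n))

/-- The linear extension of `gradedBot`. -/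
def preBot (X : GradedDiagram n) : PreCob n ⥤ PreCob n :=
  Free.lift R (gradedBot X ⋙ Free.embedding R (GradedDiagram n))

instance (X : GradedDiagram n) : (preTop X).Additive :=
  inferInstanceAs (Free.lift R _).Additive

instance (X : GradedDiagram n) : (preBot X).Additive :=
  inferInstanceAs (Free.lift R _).Additive

/-- A place in a diagram where a small circle can be inserted. -/
structure CircleSite (n : ℕ) : Type where
  u : List Layer
  v : List Layer
  i : ℕ
  isTangle : IsTangle n n (u ++ v)
  isTangle' : IsTangle n n (u ++ [.cap i, .cup i] ++ v)

namespace CircleSite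

variable (s : CircleSite n)

/-- The diagram without the circle. -/
def out : Diagram n := ⟨s.u ++ s.v, s.isTangle⟩

/-- The diagram with the circle. -/
def circ : Diagram n := ⟨s.u ++ [.cap s.i, .cup s.i] ++ s.v, s.isTangle'⟩

/-- The circle is born. -/
def birth : Movie s.out s.circ :=
  .ofStep ⟨s.u, s.v, [], _, .birth s.i, by simp [out], rfl, trivial⟩

/-- The circle dies. -/
def death : Movie s.circ s.out :=
  .ofStep ⟨s.u, s.v, _, [], .death s.i, rfl, by simp [out], trivial⟩

theorem lt_width {m k i : ℕ} {u v : List Layer} (h : IsTangle m k (u ++ .cap i :: v)) :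
    i < width m (u ++ [.cap i]) := by
  induction u generalizing m with
  | nil => have := h.1; simp only [List.nil_append, width]; omega
  | cons L u ih => cases L <;> exact ih h.2

/-- A dot on the circle. -/
def dot : Movie s.circ s.circ :=
  .ofStep ⟨s.u ++ [.cap s.i], .cup s.i :: s.v, [], [], .dot s.i, by simp [circ], by simp [circ],
    lt_width (v := .cup s.i :: s.v) (by simpa using s.isTangle')⟩

end CircleSite

/-- The relations in `Cob n`: the smallest linear congruence, stable under composition and under
gluing of diagrams on top and below, that identifies equivalent cobordisms and contains the sphere
relations and neck cutting. -/
inductive Rel (n : ℕ) : ∀ ⦃X Y : PreCob n⦄, (X ⟶ Y) → (X ⟶ Y) → Prop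
  | equivalent {a b : Diagram n} (p q : ℤ) (m m' : Movie a b) (h : m.Equivalent m') :
      Rel n (lin p q m) (lin p q m')
  | sphere (s : CircleSite n) (p q : ℤ) : Rel n (lin p q (s.birth.comp s.death)) 0
  | sphere_dot (s : CircleSite n) (p q : ℤ) :
      Rel n (lin p q (s.birth.comp (s.dot.comp s.death))) (lin p q .nil)
  | sphere_dot_dot (s : CircleSite n) (p q : ℤ) :
      Rel n (lin p q (s.birth.comp (s.dot.comp (s.dot.comp s.death)))) 0
  | sphere_dot_dot_dot (s : CircleSite n) (p q : ℤ) :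
      Rel n (lin p q (s.birth.comp (s.dot.comp (s.dot.comp (s.dot.comp s.death)))))
        (alpha • lin p q .nil)
  | neck (s : CircleSite n) (p q : ℤ) :
      Rel n (lin p q (.nil : Movie s.circ s.circ))
        (lin p q (s.death.comp (s.birth.comp s.dot)) + lin p q (s.dot.comp (s.death.comp s.birth)))
  | refl {X Y : PreCob n} (f : X ⟶ Y) : Rel n f f
  | symm {X Y : PreCob n} {f g : X ⟶ Y} : Rel n f g → Rel n g f
  | trans {X Y : PreCob n} {f g h : X ⟶ Y} : Rel n f g → Rel n g h → Rel n f h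
  | add {X Y : PreCob n} {f g f' g' : X ⟶ Y} : Rel n f g → Rel n f' g' → Rel n (f + f') (g + g')
  | smul {X Y : PreCob n} (r : R) {f g : X ⟶ Y} : Rel n f g → Rel n (r • f) (r • g)
  | comp_left {X Y Z : PreCob n} (f : X ⟶ Y) {g g' : Y ⟶ Z} : Rel n g g' → Rel n (f ≫ g) (f ≫ g')
  | comp_right {X Y Z : PreCob n} {f f' : X ⟶ Y} (g : Y ⟶ Z) : Rel n f f' → Rel n (f ≫ g) (f' ≫ g)
  | glueTop {X Y : PreCob n} (D : GradedDiagram n) {f g : X ⟶ Y} :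
      Rel n f g → Rel n ((preTop D).map f) ((preTop D).map g)
  | glueBot {X Y : PreCob n} (D : GradedDiagram n) {f g : X ⟶ Y} :
      Rel n f g → Rel n ((preBot D).map f) ((preBot D).map g)

/-- The relations, as a relation on the morphisms of `PreCob n`. -/
def rel (n : ℕ) : HomRel (PreCob n) := fun _ _ f g => Rel n f g

instance (n : ℕ) : Congruence (rel n) where
  equivalence := ⟨Rel.refl, Rel.symm, Rel.trans⟩
  comp_left f _ _ h := Rel.comp_left f h
  comp_right g h := Rel.comp_right g h

/-- The category of `q`-graded diagrams and `ℤ[α]`-linear combinations (of arbitrary degree) of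
dotted cobordisms modulo the local relations. -/
abbrev Cob (n : ℕ) : Type := Quotient (rel n)

instance (n : ℕ) : Preadditive (Cob n) :=
  Quotient.preadditive _ fun _ _ _ _ _ _ h h' => Rel.add h h'

instance (n : ℕ) : (Quotient.functor (rel n)).Additive where
  map_add := rfl

namespace Cob

/-- The object `q ^ j a` of `Cob n`. -/
def obj (a : Diagram n) (j : ℤ) : Cob n :=
  (Quotient.functor (rel n)).obj (Free.of R ⟨a, j⟩)

/-- The diagram of an object. -/
def diagram (X : Cob n) : Diagram n := GradedDiagram.diagram X.as

/-- The `q`-degree of an object. -/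
def deg (X : Cob n) : ℤ := GradedDiagram.deg X.as

/-- The morphism `r [m]`, for a cobordism `m` and a scalar `r`. -/
def ofMovie {X Y : Cob n} (r : R) (m : Movie X.diagram Y.diagram) : X ⟶ Y :=
  (Quotient.functor (rel n)).map (X := X.as) (Y := Y.as)
    (r • lin X.deg Y.deg m)

/-- The morphisms of degree `0`: sums of terms `± α ^ k [m]` with
`deg_t m + deg_q m + k deg α = 0`, where `deg_q m` is the difference of the `q`-degrees and
`deg α = -4`. -/
def degreeZero (X Y : Cob n) : AddSubgroup (X ⟶ Y) :=
  AddSubgroup.closure {f | ∃ (k : ℕ) (m : Movie X.diagram Y.diagram),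
    m.degree + (Y.deg - X.deg) - 4 * (k : ℤ) = 0 ∧ f = ofMovie (alpha ^ k) m}

/-- The functor `D ⊗ -`: glue `D` on top. -/
def tensorLeft (D : GradedDiagram n) : Cob n ⥤ Cob n :=
  CategoryTheory.Quotient.lift _ (preTop D ⋙ Quotient.functor (rel n))
    fun _ _ _ _ h => CategoryTheory.Quotient.sound _ (Rel.glueTop D h)

/-- The functor `- ⊗ D`: glue `D` below. -/
def tensorRight (D : GradedDiagram n) : Cob n ⥤ Cob n :=
  CategoryTheory.Quotient.lift _ (preBot D ⋙ Quotient.functor (rel n))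
    fun _ _ _ _ h => CategoryTheory.Quotient.sound _ (Rel.glueBot D h)

instance (D : GradedDiagram n) : (tensorLeft D).Additive where
  map_add {_ _ f g} := by
    induction f using Quot.inductionOn with | _ f
    induction g using Quot.inductionOn with | _ g
    exact congrArg (Quotient.functor (rel n)).map ((preTop D).map_add)

instance (D : GradedDiagram n) : (tensorRight D).Additive where
  map_add {_ _ f g} := by
    induction f using Quot.inductionOn with | _ f
    induction g using Quot.inductionOn with | _ g
    exact congrArg (Quotient.functor (rel n)).map ((preBot D).map_add)

end Cob

instance mapMat_additive {C D : Type*} [Category.{0} C] [Preadditive C] [Category.{0} D] [Preadditive D]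
    (F : C ⥤ D) [F.Additive] : F.mapMat_.Additive where
  map_add {_ _ f g} := by
    ext i j
    exact F.map_add

instance (n : ℕ) : HasBinaryBiproducts (Mat_ (Cob n)) :=
  hasBinaryBiproducts_of_finite_biproducts _

/-! ### Chain complexes and universal projectors -/

/-- All entries of the matrix have degree `0`. -/
def IsDegreeZero {M N : Mat_ (Cob n)} (f : M ⟶ N) : Prop :=
  ∀ i j, f i j ∈ Cob.degreeZero (M.X i) (N.X j)

/-- Cochain complexes over `Mat (Cob n)`; the differential raises the homological degree. -/
abbrev Cpx (n : ℕ) : Type 1 := CochainComplex (Mat_ (Cob n)) ℤ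

/-- The condition that defines the objects of `Kom n`: the complex is bounded below. -/
def InKom (P : Cpx n) : Prop := ∃ N : ℤ, ∀ k < N, IsZero (P.X k)

/-- `P ≃ 0`, by a homotopy of degree `0`. -/
def Contractible (P : Cpx n) : Prop :=
  ∃ h : Homotopy (𝟙 P) 0, ∀ i j, IsDegreeZero (h.hom i j)

/-- `D ⊗ P`, where the diagram `D` is placed in homological degree `0`. -/
def tensorLeft (D : Diagram n) (P : Cpx n) : Cpx n :=
  ((Cob.tensorLeft ⟨D, 0⟩).mapMat_.mapHomologicalComplex _).obj P

/-- `P ⊗ D`, where the diagram `D` is placed in homological degree `0`. -/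
def tensorRight (P : Cpx n) (D : Diagram n) : Cpx n :=
  ((Cob.tensorRight ⟨D, 0⟩).mapMat_.mapHomologicalComplex _).obj P

/-- The identity diagram: `n` vertical strands. -/
def one (n : ℕ) : Diagram n := ⟨[], rfl⟩

/-- The generator that connects the strands `i` and `i + 1` (counted from `0`) on top, and also at
the bottom. -/
def e (i : ℕ) (h : i + 2 ≤ n) : Diagram n :=
  ⟨[.cup i, .cap i], by simp only [IsTangle]; omega⟩

/-- The object `q ^ j a` of `Mat (Cob n)`. -/
def shifted (a : Diagram n) (j : ℤ) : Mat_ (Cob n) := (Mat_.embedding (Cob n)).obj (Cob.obj a j)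

/-- Universal projectors. Isomorphisms and homotopies are of degree `0` where their existence is
required, and of any degree where it is excluded. -/
structure IsUniversalProjector (P : Cpx n) : Prop where
  inKom : InKom P
  isZero_of_neg : ∀ k < 0, IsZero (P.X k)
  deg_nonneg : ∀ k > 0, ∀ i, 0 ≤ ((P.X k).X i).deg
  d_degreeZero : ∀ k : ℤ, IsDegreeZero (P.d k (k + 1))
  zero_iso : ∃ f : P.X 0 ≅ shifted (one n) 0, IsDegreeZero f.hom ∧ IsDegreeZero f.inv
  not_iso : ∀ k > 0, ∀ D : Mat_ (Cob n), ¬ Nonempty (P.X k ≅ shifted (one n) 0 ⊞ D)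
  tensor_e : ∀ (i : ℕ) (h : i + 2 ≤ n), Contractible (tensorRight P (e i h))
  e_tensor : ∀ (i : ℕ) (h : i + 2 ≤ n), Contractible (tensorLeft (e i h) P)

/-! ### The complex `P₂` -/

/-- The diagram `e₁` with two strands. -/
def e₁ : Diagram 2 := e 0 le_rfl

/-- The saddle from the identity diagram to `e₁`. -/
def saddle : Movie (one 2) e₁ :=
  .ofStep ⟨[], [], [], _, .saddle 0, rfl, rfl, trivial⟩

/-- The dot on the top arc of `e₁`. -/
def dotTop : Movie e₁ e₁ :=
  .ofStep ⟨[], e₁.word, [], [], .dot 0, rfl, rfl, Nat.zero_lt_two⟩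

/-- The dot on the bottom arc of `e₁`. -/
def dotBot : Movie e₁ e₁ :=
  .ofStep ⟨e₁.word, [], [], [], .dot 0, rfl, rfl, Nat.zero_lt_two⟩

/-- A cobordism as a `1 × 1` matrix. -/
def mat {a b : Diagram n} (p q : ℤ) (m : Movie a b) : shifted a p ⟶ shifted b q :=
  (Mat_.embedding (Cob n)).map (Cob.ofMovie (X := Cob.obj a p) (Y := Cob.obj b q) 1 m)

/-- The chain groups: the identity diagram in degree `0`, and `q ^ (2k-1) e₁` in degree `k > 0`. -/
def P₂X : ℤ → Mat_ (Cob 2)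
  | .ofNat 0 => shifted (one 2) 0
  | .ofNat (k + 1) => shifted e₁ (2 * ((k : ℤ) + 1) - 1)
  | .negSucc _ => ⟨Empty, Empty.elim⟩

/-- The differential: the saddle in degree `0`, the dot on top minus the dot at the bottom in odd
degrees `k > 0`, and their sum in even degrees `k > 0`. -/
def P₂d : (k : ℤ) → (P₂X k ⟶ P₂X (k + 1))
  | .ofNat 0 => mat 0 _ saddle
  | .ofNat (k + 1) =>
      if Odd (k + 1) then mat _ _ dotTop - mat _ _ dotBot else mat _ _ dotTop + mat _ _ dotBot
  | .negSucc _ => 0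

end BarNatan

end

noncomputable section

namespace BarNatan

variable {n : ℕ}

/-! ### A state sum: the Frobenius algebra `𝔽₁₇[x] / (x² - 1)` in its basis of idempotents -/

/-! The proof combines a calculation with the local relations, which yields the complex and its
contractions, with an invariant of `Cob 2`, which shows that the identity diagram is not a summand
of `e₁`.

Calculation. Dots slide within a component and past events elsewhere (`equivalent_dot_move`,
`equivalent_dot_comm`), and a circle that splits off an arc and dies changes nothing
(`equivalent_saddle_death`). Cutting the tube between arc and circle writes the splitting saddle as
the birth of a dotted circle plus a birth beside the dotted arc (`Arc.cls_split`). Hence `t²` and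
`b²` both equal a sphere with three dots beside the identity, so `(t - b)(t + b) = 0`. The saddle
followed by `t - b` vanishes since its surface is connected. After gluing with `e₁`, one of the dots
`t`, `b` lies on a closed circle; call it `c` and the other one `x`. Let `s` kill the circle and
create a new one. Neck cutting says `cs + sc = 1`, and `xs = sx`, so `(c ± x)s + s(c ∓ x) = 1`: up
to sign, `s` is a contracting homotopy (`Arc.homotopy`). At the left end the death of the circle
takes its place (`Arc.homotopy_split`).

Invariant. Take `𝔽₁₇[x]/(x² - 1)` with counit `ε(1) = 0`, `ε(x) = 1`. On its idempotents a dot acts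
by `±1` and `ε` takes the values `±1/2`. Colour the components of a surface by idempotents and
weight each component by the dot eigenvalues times a power of `√ε` given by its Euler
characteristic. Modulo 17 the roots exist: `1/2 = 9 = 3²` and `-1/2 = 8 = 5²`. Summing over
colourings turns movies into matrices and composition into matrix products. The weight is a product
over components, so equivalent movies have equal matrices; the sphere and neck relations hold with
`α = 1`, and gluing preserves equality of matrices. So the matrix is defined on `Cob n`
(`Rel.homMatrix_eq`).

An entry vanishes unless both colourings agree at the end points. A colouring of `e₁` gives its two
top end points one colour, so a composite through `e₁` has entry `0` where the two strands of the
identity diagram have different colours; the identity has entry `1` there. Thus the identity diagram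
is not a retract of `e₁`, whatever the degrees (`comp_ne_id`). -/

instance : Fact (Nat.Prime 17) := ⟨by norm_num⟩

/-- The eigenvalues of a dot. -/
def dotValue (c : Bool) : ZMod 17 := if c then 1 else -1

/-- A square root of the value of the counit on an idempotent. -/
def diskValue (c : Bool) : ZMod 17 := if c then 3 else 5

theorem diskValue_ne_zero (c : Bool) : diskValue c ≠ 0 := by
  revert c; decide

/-- The weight of a component with relative Euler characteristic `χ` and `d` dots. -/
def weight (χ : ℤ) (d : ℕ) (c : Bool) : ZMod 17 := diskValue c ^ χ * dotValue c ^ d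

theorem weight_zero (c : Bool) : weight 0 0 c = 1 := by simp [weight]

theorem weight_add (χ χ' : ℤ) (d d' : ℕ) (c : Bool) :
    weight (χ + χ') (d + d') c = weight χ d c * weight χ' d' c := by
  simp only [weight, zpow_add₀ (diskValue_ne_zero c), pow_add]
  ring

/-- The points of a diagram form a finite type. -/
instance Diagram.finite_pt (a : Diagram n) : Finite a.Pt := by
  refine Set.Finite.to_subtype
    (s := {z : ℕ × ℕ | z.1 ≤ a.word.length ∧ z.2 < width n (a.word.take z.1)}) ?_
  refine Set.Finite.subset (s := ⋃ l ∈ Set.Iic a.word.length,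
    (fun j => (l, j)) '' Set.Iio (width n (a.word.take l))) ?_ ?_
  · exact Set.Finite.biUnion (Set.finite_Iic _) fun l _ => (Set.finite_Iio _).image _
  · rintro ⟨l, j⟩ ⟨h, h'⟩
    simp only [Set.mem_iUnion]
    exact ⟨l, h, j, h', rfl⟩

instance Movie.finite_pt {a b : Diagram n} (m : Movie a b) : Finite m.Pt := by
  induction m with
  | nil => exact a.finite_pt
  | snoc m s ih => exact inferInstanceAs (Finite (m.Pt ⊕ _))

instance Movie.finite_component {a b : Diagram n} (m : Movie a b) : Finite m.Component :=
  inferInstanceAs (Finite (Quot m.Joined))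

/-- Colourings of the components of a diagram. -/
abbrev Diagram.Coloring (a : Diagram n) : Type :=
  {σ : a.Pt → Bool // ∀ p q, a.Joined p q → σ p = σ q}

instance (a : Diagram n) : Fintype a.Coloring := Fintype.ofFinite _

open Classical in
instance (a : Diagram n) : DecidableEq a.Coloring := inferInstance

namespace Step

variable {a b : Diagram n} (s : Step a b)

/-- An event has a single site, so it sees at most one point of the two slices; it sees none if the
site is not a point of the diagram. All products over colours or components therefore have at most
one nontrivial factor. -/
theorem meets_cases :
    (∀ A B, ¬ s.Meets A B) ∨ (∃ p, ∀ A B, s.Meets A B ↔ A p) ∨ ∃ q, ∀ A B, s.Meets A B ↔ B q := by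
  unfold Meets
  rcases s.event.site with z | z
  · by_cases h : ∃ p : a.Pt, p.1 = (s.u.length + z.1, z.2)
    · obtain ⟨p, hp⟩ := h
      refine .inr (.inl ⟨p, fun A B => ⟨?_, fun h => ⟨p, hp, h⟩⟩⟩)
      rintro ⟨p', hp', h⟩
      rwa [Subtype.ext (hp.trans hp'.symm)]
    · exact .inl fun A B ⟨p, hp, _⟩ => h ⟨p, hp⟩
  · by_cases h : ∃ p : b.Pt, p.1 = (s.u.length + z.1, z.2)
    · obtain ⟨p, hp⟩ := h
      refine .inr (.inr ⟨p, fun A B => ⟨?_, fun h => ⟨p, hp, h⟩⟩⟩)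
      rintro ⟨p', hp', h⟩
      rwa [Subtype.ext (hp.trans hp'.symm)]
    · exact .inl fun A B ⟨p, hp, _⟩ => h ⟨p, hp⟩

open Classical in
/-- The weight of the event of a step, between two coloured slices. -/
def colorWeight (σ : a.Pt → Bool) (τ : b.Pt → Bool) : ZMod 17 :=
  ∏ c : Bool, if s.Meets (fun p => σ p = c) (fun q => τ q = c) then
    weight s.event.chi s.event.dots c else 1

open Classical in
-- Since the event sees at most one point, grouping the points by colour or by a finer label gives
-- the same product. The label used later is the component.
theorem colorWeight_comp {I : Type} [Fintype I] (f : a.Pt → I) (f' : b.Pt → I) (g : I → Bool) :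
    s.colorWeight (g ∘ f) (g ∘ f') =
      ∏ i, if s.Meets (fun p => f p = i) (fun q => f' q = i) then
        weight s.event.chi s.event.dots (g i) else 1 := by
  unfold colorWeight
  rcases s.meets_cases with h | ⟨p, h⟩ | ⟨p, h⟩ <;> simp [h]

open Classical in
/-- The matrix of a step. -/
def matrix : Matrix a.Coloring b.Coloring (ZMod 17) := fun σ τ =>
  if ∀ p q, s.Matches p q → σ.1 p = τ.1 q then s.colorWeight σ.1 τ.1 else 0

end Step

namespace Movie

variable {a : Diagram n}

/-- The matrix of a movie. -/
def matrix : {b : Diagram n} → Movie a b → Matrix a.Coloring b.Coloring (ZMod 17)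
  | _, nil => 1
  | _, snoc m s => matrix m * s.matrix

theorem matrix_comp {b c : Diagram n} (m : Movie a b) (m' : Movie b c) :
    (m.comp m').matrix = m.matrix * m'.matrix := by
  induction m' with
  | nil => simp [comp, matrix]
  | snoc m s ih => simp only [comp, matrix, ih, Matrix.mul_assoc]

/-- The weight of a coloured movie. -/
def colorWeight : {b : Diagram n} → (m : Movie a b) → (m.Pt → Bool) → ZMod 17
  | _, nil, _ => 1
  | _, snoc m s, κ =>
      colorWeight m (fun p => κ (Sum.inl p)) *
        s.colorWeight (fun p => κ (Sum.inl (last m p))) (fun q => κ (Sum.inr q))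

/-- Taking components as labels, this expresses the weight through exactly the data that
`Equivalent` preserves: Euler characteristic and number of dots of each component. -/
theorem colorWeight_comp {I : Type} [Fintype I] (g : I → Bool) {b : Diagram n} (m : Movie a b)
    (f : m.Pt → I) :
    m.colorWeight (g ∘ f) =
      ∏ i, weight (m.chi fun p => f p = i) (m.dots fun p => f p = i) (g i) := by
  induction m with
  | nil => simp [colorWeight, chi, dots, weight_zero]
  | snoc m s ih =>
    have h := ih (fun p => f (Sum.inl p))
    have h' := s.colorWeight_comp (fun p => f (Sum.inl (last m p))) (fun q => f (Sum.inr q)) g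
    simp only [Function.comp_def] at h h' ⊢
    simp only [colorWeight, chi, dots, weight_add, Finset.prod_mul_distrib, h, h']
    congr 1
    refine Finset.prod_congr rfl fun i _ => ?_
    split_ifs <;> simp [weight_zero]

theorem joined_last {b : Diagram n} (m : Movie a b) (p q : b.Pt) (h : b.Joined p q) :
    m.Joined (m.last p) (m.last q) := by
  cases m <;> exact h

/-- The colouring is constant on components. -/
def Invariant {b : Diagram n} (m : Movie a b) (κ : m.Pt → Bool) : Prop :=
  ∀ p q, m.Joined p q → κ p = κ q

theorem invariant_snoc {b c : Diagram n} (m : Movie a b) (s : Step b c) (κ : m.Pt → Bool)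
    (τ : c.Pt → Bool) :
    (m.snoc s).Invariant (Sum.elim κ τ) ↔
      m.Invariant κ ∧ (∀ p q, s.Matches p q → κ (m.last p) = τ q) ∧
        ∀ p q, c.Joined p q → τ p = τ q := by
  constructor
  · intro h
    exact ⟨fun p q hpq => h (.inl p) (.inl q) hpq,
      fun p q hpq => h (.inl (m.last p)) (.inr q) ⟨p, rfl, hpq⟩,
      fun p q hpq => h (.inr p) (.inr q) hpq⟩
  · rintro ⟨h, h', h''⟩ (p | p) (q | q) hpq
    · exact h p q hpq
    · obtain ⟨r, rfl, hr⟩ := hpq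
      exact h' r q hr
    · exact hpq.elim
    · exact h'' p q hpq

instance (a : Diagram n) : Fintype a.Pt := Fintype.ofFinite _

instance {b : Diagram n} (m : Movie a b) : Fintype m.Pt := Fintype.ofFinite _

instance {b : Diagram n} (m : Movie a b) : Fintype m.Component := Fintype.ofFinite _

open Classical in
/-- The matrix entries of a movie are sums over the colourings of its components. -/
theorem matrix_apply {b : Diagram n} (m : Movie a b) (σ : a.Coloring) (τ : b.Coloring) :
    m.matrix σ τ = ∑ κ : m.Pt → Bool,
      if m.Invariant κ ∧ κ ∘ m.first = σ.1 ∧ κ ∘ m.last = τ.1 then m.colorWeight κ else 0 := by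
  induction m with
  | nil =>
    refine Eq.trans ?_ (Finset.sum_eq_single (σ.1 : (nil : Movie a a).Pt → Bool) ?_ ?_).symm
    · by_cases h : σ = τ
      · subst h
        have : (nil : Movie a a).Invariant σ.1 := σ.2
        simp only [matrix, Matrix.one_apply_eq, this, true_and]
        rw [if_pos ⟨rfl, rfl⟩]; rfl
      · rw [if_neg, matrix, Matrix.one_apply_ne h]
        rintro ⟨-, -, h'⟩
        exact h (Subtype.ext h')
    · intro κ _ hκ
      rw [if_neg]
      rintro ⟨-, h', -⟩
      exact hκ h'
    · intro h
      exact (h (Finset.mem_univ (α := (nil : Movie a a).Pt → Bool) _)).elim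
  | @snoc b c m s ih =>
    -- The middle colouring `ρ` of the matrix product is encoded as the condition `κ ∘ m.last =
    -- ρ.1`, so that after exchanging the sums `ρ` can be eliminated.
    have key : ∀ ρ : b.Coloring, m.matrix σ ρ * s.matrix ρ τ = ∑ κ : m.Pt → Bool,
        if κ ∘ m.last = ρ.1 then
          if m.Invariant κ ∧ κ ∘ m.first = σ.1 then
            if ∀ p q, s.Matches p q → κ (m.last p) = τ.1 q then
            m.colorWeight κ * s.colorWeight (κ ∘ m.last) τ.1 else 0 else 0 else 0 := by
      intro ρ
      rw [ih, Finset.sum_mul]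
      refine Finset.sum_congr rfl fun κ _ => ?_
      by_cases h : κ ∘ m.last = ρ.1
      · simp only [h, and_true, if_true, Step.matrix]
        have : ∀ p, κ (m.last p) = ρ.1 p := fun p => congrFun h p
        simp only [this]
        split_ifs <;> simp
      · simp [h]
    simp only [matrix, Matrix.mul_apply, key]
    rw [Finset.sum_comm]
    have e : (∑ κ : (m.snoc s).Pt → Bool,
        if (m.snoc s).Invariant κ ∧ κ ∘ (m.snoc s).first = σ.1 ∧ κ ∘ (m.snoc s).last = τ.1 then
          (m.snoc s).colorWeight κ else 0) =
        ∑ κ : (m.Pt → Bool) × (c.Pt → Bool),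
        if (m.snoc s).Invariant (Sum.elim κ.1 κ.2) ∧ κ.1 ∘ m.first = σ.1 ∧ κ.2 = τ.1 then
          m.colorWeight κ.1 * s.colorWeight (κ.1 ∘ m.last) κ.2 else 0 := by
      let E : ((m.snoc s).Pt → Bool) ≃ (m.Pt → Bool) × (c.Pt → Bool) :=
        Equiv.sumArrowEquivProdArrow m.Pt c.Pt Bool
      refine Fintype.sum_equiv E _ _ fun κ => ?_
      have : Sum.elim (E κ).1 (E κ).2 = κ := Sum.elim_comp_inl_inr κ
      rw [this]
      rfl
    rw [e, Fintype.sum_prod_type]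
    refine Finset.sum_congr rfl fun κ _ => ?_
    refine Eq.trans ?_ (Finset.sum_eq_single τ.1 ?_ ?_).symm
    · have hs := invariant_snoc m s κ τ.1
      by_cases hκ : m.Invariant κ ∧ κ ∘ m.first = σ.1
      -- Invariance of `κ` makes its last slice a colouring, which is the only `ρ` that survives.
      · have hl : ∀ p q, b.Joined p q → (κ ∘ m.last) p = (κ ∘ m.last) q :=
          fun p q h => hκ.1 _ _ (m.joined_last p q h)
        refine (Finset.sum_eq_single (⟨κ ∘ m.last, hl⟩ : b.Coloring) ?_ ?_).trans ?_
        · intro ρ _ hρ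
          rw [if_neg]
          exact fun h => hρ (Subtype.ext h.symm)
        · exact fun h => (h (Finset.mem_univ _)).elim
        · rw [if_pos rfl, if_pos hκ]
          refine if_congr ?_ rfl rfl
          rw [hs]
          exact ⟨fun h => ⟨⟨hκ.1, h, τ.2⟩, hκ.2, rfl⟩, fun h => h.1.2.1⟩
      · refine Eq.trans ?_ (if_neg fun h => hκ ⟨(hs.1 h.1).1, h.2.1⟩).symm
        refine Finset.sum_eq_zero fun ρ _ => ?_
        rw [if_neg hκ, ite_self]
    · intro τ' _ h
      rw [if_neg]
      exact fun h' => h h'.2.2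
    · exact fun h => (h (Finset.mem_univ _)).elim

/-- The component of a point. -/
def component {b : Diagram n} (m : Movie a b) (p : m.Pt) : m.Component := Quot.mk _ p

open Classical in
-- Invariant colourings of the points are those that factor through the components, and all others
-- contribute zero.
theorem matrix_apply_component {b : Diagram n} (m : Movie a b) (σ : a.Coloring) (τ : b.Coloring) :
    m.matrix σ τ = ∑ κ : m.Component → Bool,
      if (∀ p, κ (m.component (m.first p)) = σ.1 p) ∧ ∀ q, κ (m.component (m.last q)) = τ.1 q then
        m.colorWeight (κ ∘ m.component) else 0 := by
  rw [matrix_apply]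
  symm
  refine Finset.sum_of_injOn (fun κ => κ ∘ m.component) ?_ ?_ ?_ ?_
  · intro κ _ κ' _ hκ
    funext c
    induction c using Quot.ind with | _ p
    exact congrFun hκ p
  · exact fun _ _ => Finset.mem_coe.2 (Finset.mem_univ _)
  · intro κ _ hκ
    rw [if_neg]
    rintro ⟨hi, -⟩
    exact hκ ⟨Quot.lift κ hi, Finset.mem_coe.2 (Finset.mem_univ _), rfl⟩
  · intro κ _
    have hi : m.Invariant (κ ∘ m.component) := fun p q hpq => congrArg κ (Quot.sound hpq)
    refine if_congr ?_ rfl rfl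
    rw [funext_iff, funext_iff]
    exact ⟨fun h => ⟨hi, h⟩, fun h => h.2⟩

open Classical in
/-- Equivalent movies have the same matrix. -/
theorem Equivalent.matrix_eq {b : Diagram n} {m m' : Movie a b} (h : m.Equivalent m') :
    m.matrix = m'.matrix := by
  obtain ⟨φ, h₁, h₂, h₃, h₄⟩ := h
  ext σ τ
  rw [matrix_apply_component, matrix_apply_component]
  refine Fintype.sum_equiv (φ.arrowCongr (Equiv.refl Bool)) _ _ fun κ => ?_
  have e (c : m.Component) : (φ.arrowCongr (Equiv.refl Bool)) κ (φ c) = κ c :=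
    congrArg κ (φ.symm_apply_apply c)
  refine if_congr ?_ ?_ rfl
  · refine and_congr (forall_congr' fun p => ?_) (forall_congr' fun p => ?_)
    · rw [show m'.component (m'.first p) = φ (m.component (m.first p)) from (h₁ p).symm, e]
    · rw [show m'.component (m'.last p) = φ (m.component (m.last p)) from (h₂ p).symm, e]
  · rw [colorWeight_comp, colorWeight_comp]
    refine Fintype.prod_equiv φ _ _ fun c => ?_
    rw [e]
    exact congrArg₂ (fun x y => weight x y (κ c)) (h₃ c) (h₄ c)

end Movie

/-! ### Gluing and the state sum -/

theorem Layer.Joins.shift {L : Layer} {l : ℕ} {p q : ℕ × ℕ} (k : ℕ) (h : L.Joins l p q) :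
    L.Joins (k + l) (k + p.1, p.2) (k + q.1, q.2) := by
  cases h <;> constructor <;> assumption

theorem Layer.Joins.le {L : Layer} {l : ℕ} {p q : ℕ × ℕ} (h : L.Joins l p q) :
    (l ≤ p.1 ∧ p.1 ≤ l + 1) ∧ l ≤ q.1 ∧ q.1 ≤ l + 1 := by
  cases h <;> simp

theorem Layer.Joins.unshift {L : Layer} {l k : ℕ} {p q : ℕ × ℕ} (h : L.Joins (k + l) p q) :
    L.Joins l (p.1 - k, p.2) (q.1 - k, q.2) := by
  generalize hm : k + l = m at h
  have h₁ : m - k = l := by omega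
  have h₂ : m + 1 - k = l + 1 := by omega
  cases h <;> simp only [h₁, h₂] <;> constructor <;> assumption

namespace Diagram

theorem width_word (a : Diagram n) : width n a.word = n := a.isTangle.width_eq

/-- The end points on the top side. -/
def firstPt (a : Diagram n) (j : Fin n) : a.Pt := ⟨(0, j), Nat.zero_le _, by simp [width]⟩

/-- The end points at the bottom. -/
def lastPt (a : Diagram n) (j : Fin n) : a.Pt :=
  ⟨(a.word.length, j), le_rfl, by simp [width_word]⟩

variable {a b : Diagram n}

theorem width_tensor_add (a b : Diagram n) (l : ℕ) :
    width n ((a.tensor b).word.take (a.word.length + l)) = width n (b.word.take l) := by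
  simp [tensor, List.take_append, width_append, List.take_of_length_le, width_word]

theorem width_tensor (a b : Diagram n) {l : ℕ} (h : l ≤ a.word.length) :
    width n ((a.tensor b).word.take l) = width n (a.word.take l) := by
  simp [tensor, List.take_append_of_le_length h]

theorem length_tensor (a b : Diagram n) :
    (a.tensor b).word.length = a.word.length + b.word.length := by
  simp [tensor]

/-- The points of the upper factor. -/
def topPt (b : Diagram n) (p : a.Pt) : (a.tensor b).Pt :=
  ⟨p.1, by rw [length_tensor]; exact p.2.1.trans (Nat.le_add_right _ _), by
    rw [width_tensor a b p.2.1]; exact p.2.2⟩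

/-- The points of the lower factor. -/
def botPt (a : Diagram n) (p : b.Pt) : (a.tensor b).Pt :=
  ⟨(a.word.length + p.1.1, p.1.2), by rw [length_tensor]; exact Nat.add_le_add_left p.2.1 _, by
    rw [width_tensor_add a b]; exact p.2.2⟩

/-- The gluing line is counted in both factors; this is where pasted colourings have to agree. -/
theorem topPt_lastPt (j : Fin n) : topPt b (a.lastPt j) = botPt a (b.firstPt j) := rfl

theorem exists_topPt (P : (a.tensor b).Pt) (h : P.1.1 ≤ a.word.length) :
    ∃ p : a.Pt, P = topPt b p ∧ p.1 = P.1 :=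
  ⟨⟨P.1, h, width_tensor a b h ▸ P.2.2⟩, rfl, rfl⟩

theorem exists_botPt (P : (a.tensor b).Pt) (h : a.word.length ≤ P.1.1) :
    ∃ p : b.Pt, P = botPt a p ∧ p.1 = (P.1.1 - a.word.length, P.1.2) := by
  obtain ⟨⟨l, j⟩, h₁, h₂⟩ := P
  obtain ⟨k, rfl⟩ := Nat.exists_eq_add_of_le h
  refine ⟨⟨(k, j), ?_, ?_⟩, rfl, by simp⟩
  · rw [length_tensor] at h₁
    exact Nat.le_of_add_le_add_left h₁
  · have := width_tensor_add a b k
    simp only at h₂ this ⊢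
    rwa [this] at h₂

theorem topPt_or_botPt (P : (a.tensor b).Pt) :
    (∃ p : a.Pt, P = topPt b p) ∨ ∃ p : b.Pt, P = botPt a p := by
  rcases le_total P.1.1 a.word.length with h | h
  · exact .inl (let ⟨p, hp⟩ := exists_topPt P h; ⟨p, hp.1⟩)
  · exact .inr (let ⟨p, hp⟩ := exists_botPt P h; ⟨p, hp.1⟩)

theorem joined_topPt {p q : a.Pt} (h : a.Joined p q) :
    (a.tensor b).Joined (topPt b p) (topPt b q) := by
  obtain ⟨l, L, hL, h⟩ := h
  refine ⟨l, L, ?_, h⟩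
  rw [tensor, List.getElem?_append_left (List.getElem?_eq_some_iff.1 hL).1, hL]

theorem joined_botPt {p q : b.Pt} (h : b.Joined p q) :
    (a.tensor b).Joined (botPt a p) (botPt a q) := by
  obtain ⟨l, L, hL, h⟩ := h
  refine ⟨a.word.length + l, L, ?_, h.shift _⟩
  rw [tensor, List.getElem?_append_right (Nat.le_add_right _ _), Nat.add_sub_cancel_left, hL]

theorem joined_tensor {P Q : (a.tensor b).Pt} (h : (a.tensor b).Joined P Q) :
    (∃ p q : a.Pt, P = topPt b p ∧ Q = topPt b q ∧ a.Joined p q) ∨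
      ∃ p q : b.Pt, P = botPt a p ∧ Q = botPt a q ∧ b.Joined p q := by
  obtain ⟨l, L, hL, h⟩ := h
  obtain ⟨⟨h₁, h₂⟩, h₃, h₄⟩ := h.le
  rcases Nat.lt_or_ge l a.word.length with hl | hl
  · obtain ⟨p, rfl, hp⟩ := exists_topPt P (by omega)
    obtain ⟨q, rfl, hq⟩ := exists_topPt Q (by omega)
    rw [tensor, List.getElem?_append_left hl] at hL
    exact .inl ⟨p, q, rfl, rfl, l, L, hL, h⟩
  · obtain ⟨p, rfl, hp⟩ := exists_botPt P (by omega)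
    obtain ⟨q, rfl, hq⟩ := exists_botPt Q (by omega)
    obtain ⟨k, rfl⟩ := Nat.exists_eq_add_of_le hl
    rw [tensor, List.getElem?_append_right hl, Nat.add_sub_cancel_left] at hL
    refine .inr ⟨p, q, rfl, rfl, k, L, hL, ?_⟩
    rw [hp, hq]
    exact h.unshift

namespace Coloring

/-- The restriction of a colouring to the upper factor. -/
def top (σ : (a.tensor b).Coloring) : a.Coloring :=
  ⟨fun p => σ.1 (topPt b p), fun _ _ h => σ.2 _ _ (joined_topPt h)⟩

/-- The restriction of a colouring to the lower factor. -/
def bot (σ : (a.tensor b).Coloring) : b.Coloring :=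
  ⟨fun p => σ.1 (botPt a p), fun _ _ h => σ.2 _ _ (joined_botPt h)⟩

theorem ext_top_bot {σ τ : (a.tensor b).Coloring} (h : σ.top = τ.top) (h' : σ.bot = τ.bot) :
    σ = τ := by
  ext P
  rcases topPt_or_botPt P with ⟨p, rfl⟩ | ⟨p, rfl⟩
  · exact congrFun (congrArg Subtype.val h) p
  · exact congrFun (congrArg Subtype.val h') p

theorem exists_paste (α : a.Coloring) (β : b.Coloring)
    (h : ∀ j, α.1 (a.lastPt j) = β.1 (b.firstPt j)) :
    ∃ σ : (a.tensor b).Coloring, σ.top = α ∧ σ.bot = β := by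
  classical
  let f : (a.tensor b).Pt → Bool := fun P =>
    if hP : P.1.1 ≤ a.word.length then α.1 (exists_topPt P hP).choose
    else β.1 (exists_botPt P (le_of_not_ge hP)).choose
  have ht : ∀ p, f (topPt b p) = α.1 p := by
    intro p
    have hP : (topPt b p).1.1 ≤ a.word.length := p.2.1
    simp only [f, dif_pos hP]
    exact congrArg α.1 (Subtype.ext (exists_topPt _ hP).choose_spec.2)
  have hb : ∀ p, f (botPt a p) = β.1 p := by
    intro p
    -- On the gluing line `f` takes its value from `α`; the hypothesis `h` turns it into the value
    -- of `β`.
    by_cases hp : p.1.1 = 0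
    · have hj : p.1.2 < n := by
        have := p.2.2
        rw [hp] at this
        simpa [width] using this
      have : p = b.firstPt ⟨p.1.2, hj⟩ := Subtype.ext (Prod.ext hp rfl)
      rw [this, ← topPt_lastPt, ht, h]
    · have hP : ¬ (botPt a p).1.1 ≤ a.word.length := by
        simp only [botPt]; omega
      simp only [f, dif_neg hP]
      refine congrArg β.1 (Subtype.ext ((exists_botPt _ (le_of_not_ge hP)).choose_spec.2.trans ?_))
      simp [botPt]
  refine ⟨⟨f, fun P Q hPQ => ?_⟩, Subtype.ext (funext ht), Subtype.ext (funext hb)⟩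
  rcases joined_tensor hPQ with ⟨p, q, rfl, rfl, h⟩ | ⟨p, q, rfl, rfl, h⟩
  · rw [ht, ht, α.2 p q h]
  · rw [hb, hb, β.2 p q h]

end Coloring

end Diagram

open Diagram

/-- The site stays inside the slab, so a diagram glued below cannot capture it. -/
theorem Event.site_le {x y : List Layer} (E : Event x y) :
    (∀ z, E.site = .inl z → z.1 ≤ x.length) ∧ ∀ z, E.site = .inr z → z.1 ≤ y.length := by
  cases E <;> simp [site]

namespace Step

variable {a b : Diagram n} (s : Step a b)

theorem length_src : a.word.length = s.u.length + s.x.length + s.v.length := by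
  rw [s.src]; simp only [List.length_append]

theorem length_tgt : b.word.length = s.u.length + s.y.length + s.v.length := by
  rw [s.tgt]; simp only [List.length_append]

theorem matches_firstPt (j : Fin n) : s.Matches (a.firstPt j) (b.firstPt j) :=
  ⟨rfl, .inl ⟨rfl, Nat.zero_le _⟩⟩

theorem matches_lastPt (j : Fin n) : s.Matches (a.lastPt j) (b.lastPt j) :=
  ⟨rfl, .inr ⟨s.v.length, s.length_src, s.length_tgt⟩⟩

theorem matrix_eq_of_ne_zero {σ : a.Coloring} {τ : b.Coloring} (h : s.matrix σ τ ≠ 0) :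
    ∀ p q, s.Matches p q → σ.1 p = τ.1 q := by
  by_contra h'
  exact h (if_neg h')

theorem glueTop_matches (d : Diagram n) (P : (d.tensor a).Pt) (Q : (d.tensor b).Pt) :
    (s.glueTop d rfl rfl : Step (d.tensor a) (d.tensor b)).Matches P Q ↔
      (∃ p, P = topPt a p ∧ Q = topPt b p) ∨
        ∃ p q, P = botPt d p ∧ Q = botPt d q ∧ s.Matches p q := by
  have hu : (s.glueTop d rfl rfl : Step (d.tensor a) (d.tensor b)).u.length =
    d.word.length + s.u.length := List.length_append
  constructor
  · rintro ⟨h, ⟨h₁, h₂⟩ | ⟨r, h₁, h₂⟩⟩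
    · by_cases hP : P.1.1 ≤ d.word.length
      · obtain ⟨p, rfl, hp⟩ := exists_topPt P hP
        exact .inl ⟨p, rfl, Subtype.ext (Prod.ext h₁.symm h.symm)⟩
      · obtain ⟨p, rfl, hp⟩ := exists_botPt P (by omega)
        obtain ⟨q, rfl, hq⟩ := exists_botPt Q (by omega)
        refine .inr ⟨p, q, rfl, rfl, h, .inl ?_⟩
        rw [hu] at h₂
        simp only [botPt] at h₁ h₂
        omega
    · rw [hu] at h₁ h₂
      obtain ⟨p, rfl, hp⟩ := exists_botPt P (by omega)
      obtain ⟨q, rfl, hq⟩ := exists_botPt Q (by omega)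
      refine .inr ⟨p, q, rfl, rfl, h, .inr ⟨r, ?_⟩⟩
      simp only [botPt, glueTop] at h₁ h₂
      omega
  · rintro (⟨p, rfl, rfl⟩ | ⟨p, q, rfl, rfl, h, h' | ⟨r, h₁, h₂⟩⟩)
    · exact ⟨rfl, .inl ⟨rfl, by rw [hu]; exact p.2.1.trans (Nat.le_add_right _ _)⟩⟩
    · refine ⟨h, .inl ?_⟩
      rw [hu]
      simp only [botPt]
      omega
    · refine ⟨h, .inr ⟨r, ?_⟩⟩
      rw [hu]
      simp only [botPt, glueTop]
      omega

theorem glueBot_matches (d : Diagram n) (P : (a.tensor d).Pt) (Q : (b.tensor d).Pt) :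
    (s.glueBot d rfl rfl : Step (a.tensor d) (b.tensor d)).Matches P Q ↔
      (∃ p q, P = topPt d p ∧ Q = topPt d q ∧ s.Matches p q) ∨
        ∃ p, P = botPt a p ∧ Q = botPt b p := by
  have ha := s.length_src
  have hb := s.length_tgt
  constructor
  · rintro ⟨h, ⟨h₁, h₂⟩ | ⟨r, h₁, h₂⟩⟩ <;> simp only [glueBot] at h₁ h₂
    · obtain ⟨p, rfl, hp⟩ := exists_topPt P (by omega)
      obtain ⟨q, rfl, hq⟩ := exists_topPt Q (by omega)
      exact .inl ⟨p, q, rfl, rfl, h, .inl ⟨h₁, h₂⟩⟩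
    -- Points below the slab lie either in the remaining part `v` of the upper factor or in the
    -- glued diagram `d`.
    · rcases le_total r s.v.length with hr | hr
      · obtain ⟨p, rfl, hp⟩ := exists_topPt P (by omega)
        obtain ⟨q, rfl, hq⟩ := exists_topPt Q (by omega)
        exact .inl ⟨p, q, rfl, rfl, h, .inr ⟨r, h₁, h₂⟩⟩
      · obtain ⟨p, rfl, hp⟩ := exists_botPt P (by omega)
        obtain ⟨q, rfl, hq⟩ := exists_botPt Q (by omega)
        refine .inr ⟨p, rfl, congrArg _ (Subtype.ext ?_)⟩
        rw [hp, hq]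
        exact Prod.ext (by simp only; omega) h.symm
  · rintro (⟨p, q, rfl, rfl, h⟩ | ⟨p, rfl, rfl⟩)
    · exact h
    · refine ⟨rfl, .inr ⟨s.v.length + p.1.1, ?_⟩⟩
      simp only [botPt, glueBot]
      omega

theorem glueTop_meets (d : Diagram n) (A : (d.tensor a).Pt → Prop) (B : (d.tensor b).Pt → Prop) :
    (s.glueTop d rfl rfl : Step (d.tensor a) (d.tensor b)).Meets A B ↔
      s.Meets (fun p => A (botPt d p)) fun q => B (botPt d q) := by
  have hu : (s.glueTop d rfl rfl : Step (d.tensor a) (d.tensor b)).u.length =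
    d.word.length + s.u.length := List.length_append
  unfold Meets
  rw [hu]
  simp only [glueTop]
  rcases s.event.site with z | z
  all_goals
    constructor
    · rintro ⟨P, hP, hA⟩
      obtain ⟨p, rfl, hp⟩ := exists_botPt P (by rw [hP]; omega)
      refine ⟨p, ?_, hA⟩
      rw [hp, hP]
      exact Prod.ext (by simp only; omega) rfl
    · rintro ⟨p, hp, hA⟩
      refine ⟨_, ?_, hA⟩
      simp only [botPt, hp]
      exact Prod.ext (by simp only; omega) rfl

theorem glueBot_meets (d : Diagram n) (A : (a.tensor d).Pt → Prop) (B : (b.tensor d).Pt → Prop) :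
    (s.glueBot d rfl rfl : Step (a.tensor d) (b.tensor d)).Meets A B ↔
      s.Meets (fun p => A (topPt d p)) fun q => B (topPt d q) := by
  have ha := s.length_src
  have hb := s.length_tgt
  have hE := s.event.site_le
  unfold Meets
  simp only [glueBot]
  rcases hz : s.event.site with z | z
  all_goals
    have := hE.1 z
    have := hE.2 z
    constructor
    · rintro ⟨P, hP, hA⟩
      obtain ⟨p, rfl, hp⟩ := exists_topPt P (by rw [hP]; simp_all; try omega)
      exact ⟨p, hP, hA⟩
    · rintro ⟨p, hp, hA⟩
      exact ⟨_, hp, hA⟩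

open Classical in
-- The surface over `d` is a product without events: it forces equal colours and contributes weight
-- `1`.
theorem glueTop_matrix (d : Diagram n) (σ : (d.tensor a).Coloring) (τ : (d.tensor b).Coloring) :
    (s.glueTop d rfl rfl : Step (d.tensor a) (d.tensor b)).matrix σ τ =
      if σ.top = τ.top then s.matrix σ.bot τ.bot else 0 := by
  have hw : (s.glueTop d rfl rfl : Step (d.tensor a) (d.tensor b)).colorWeight σ.1 τ.1 =
      s.colorWeight σ.bot.1 τ.bot.1 := by
    unfold colorWeight
    simp only [glueTop_meets]
    rfl
  unfold matrix
  rw [hw, ← ite_and]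
  have key : (∀ P Q, (s.glueTop d rfl rfl : Step (d.tensor a) (d.tensor b)).Matches P Q →
      σ.1 P = τ.1 Q) ↔
        σ.top = τ.top ∧ ∀ p q, s.Matches p q → σ.bot.1 p = τ.bot.1 q := by
    simp only [glueTop_matches]
    rw [show σ.top = τ.top ↔ ∀ p, σ.top.1 p = τ.top.1 p from Subtype.ext_iff.trans funext_iff]
    constructor
    · exact fun h => ⟨fun p => h _ _ (.inl ⟨p, rfl, rfl⟩),
        fun p q hpq => h _ _ (.inr ⟨p, q, rfl, rfl, hpq⟩)⟩
    · rintro ⟨h, h'⟩ P Q (⟨p, rfl, rfl⟩ | ⟨p, q, rfl, rfl, hpq⟩)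
      · exact h p
      · exact h' p q hpq
  by_cases h : σ.top = τ.top ∧ ∀ p q, s.Matches p q → σ.bot.1 p = τ.bot.1 q
  · rw [if_pos h, if_pos (key.2 h)]
  · rw [if_neg h, if_neg (mt key.1 h)]

open Classical in
theorem glueBot_matrix (d : Diagram n) (σ : (a.tensor d).Coloring) (τ : (b.tensor d).Coloring) :
    (s.glueBot d rfl rfl : Step (a.tensor d) (b.tensor d)).matrix σ τ =
      if σ.bot = τ.bot then s.matrix σ.top τ.top else 0 := by
  have hw : (s.glueBot d rfl rfl : Step (a.tensor d) (b.tensor d)).colorWeight σ.1 τ.1 =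
      s.colorWeight σ.top.1 τ.top.1 := by
    unfold colorWeight
    simp only [glueBot_meets]
    rfl
  unfold matrix
  rw [hw, ← ite_and]
  have key : (∀ P Q, (s.glueBot d rfl rfl : Step (a.tensor d) (b.tensor d)).Matches P Q →
      σ.1 P = τ.1 Q) ↔
        σ.bot = τ.bot ∧ ∀ p q, s.Matches p q → σ.top.1 p = τ.top.1 q := by
    simp only [glueBot_matches]
    rw [show σ.bot = τ.bot ↔ ∀ p, σ.bot.1 p = τ.bot.1 p from Subtype.ext_iff.trans funext_iff]
    constructor
    · exact fun h => ⟨fun p => h _ _ (.inr ⟨p, rfl, rfl⟩),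
        fun p q hpq => h _ _ (.inl ⟨p, q, rfl, rfl, hpq⟩)⟩
    · rintro ⟨h, h'⟩ P Q (⟨p, q, rfl, rfl, hpq⟩ | ⟨p, rfl, rfl⟩)
      · exact h' p q hpq
      · exact h p
  by_cases h : σ.bot = τ.bot ∧ ∀ p q, s.Matches p q → σ.top.1 p = τ.top.1 q
  · rw [if_pos h, if_pos (key.2 h)]
  · rw [if_neg h, if_neg (mt key.1 h)]

end Step

namespace Movie

variable {a b : Diagram n}

/-- The vertical sides of the surface are products, so every contributing colouring is constant
along each end point. This allows pasting in the gluing formulas and yields the obstruction to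
retracts. -/
theorem matrix_eq_of_ne_zero (m : Movie a b) {σ : a.Coloring} {τ : b.Coloring}
    (h : m.matrix σ τ ≠ 0) :
    (∀ j, σ.1 (a.firstPt j) = τ.1 (b.firstPt j)) ∧ ∀ j, σ.1 (a.lastPt j) = τ.1 (b.lastPt j) := by
  induction m with
  | nil =>
    by_cases hs : σ = τ
    · subst hs; simp
    · exact (h (Matrix.one_apply_ne hs)).elim
  | snoc m s ih =>
    rw [matrix, Matrix.mul_apply] at h
    obtain ⟨ρ, -, hρ⟩ := Finset.exists_ne_zero_of_sum_ne_zero h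
    have h₁ := ih (left_ne_zero_of_mul hρ)
    have h₂ := s.matrix_eq_of_ne_zero (right_ne_zero_of_mul hρ)
    exact ⟨fun j => (h₁.1 j).trans (h₂ _ _ (s.matches_firstPt j)),
      fun j => (h₁.2 j).trans (h₂ _ _ (s.matches_lastPt j))⟩

/-- Matrix multiplication for glued surfaces: `t` restricts to the inert factor and `r` to the
active one. Freezing `t ρ = x` makes `r` injective, and `h` says that it reaches every index where
`F` is nonzero, although not every pair of colourings can be pasted. -/
theorem sum_glue {E A B K : Type} [Fintype E] [Fintype B] [DecidableEq A] [CommRing K]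
    (t : E → A) (r : E → B)
    (inj : ∀ ρ ρ', t ρ = t ρ' → r ρ = r ρ' → ρ = ρ') (x y : A) (F G : B → K)
    (h : ∀ τ, F τ ≠ 0 → ∃ ρ, t ρ = x ∧ r ρ = τ) :
    ∑ ρ, (if x = t ρ then F (r ρ) else 0) * (if t ρ = y then G (r ρ) else 0) =
      if x = y then ∑ τ, F τ * G τ else 0 := by
  split_ifs with hxy
  · subst hxy
    rw [← Finset.sum_filter_of_ne (p := fun ρ => t ρ = x)]
    · refine Finset.sum_of_injOn r ?_ ?_ ?_ ?_
      · intro ρ hρ ρ' hρ' h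
        simp only [Finset.coe_filter, Finset.mem_univ, true_and, Set.mem_ofPred_eq] at hρ hρ'
        exact inj ρ ρ' (hρ.trans hρ'.symm) h
      · exact fun _ _ => Finset.mem_coe.2 (Finset.mem_univ _)
      · intro τ _ hτ
        by_contra h'
        obtain ⟨ρ, hρ, hρ'⟩ := h τ (left_ne_zero_of_mul h')
        exact hτ ⟨ρ, by simpa using hρ, hρ'⟩
      · intro ρ hρ
        simp only [Finset.mem_filter, Finset.mem_univ, true_and] at hρ
        simp [hρ]
    · intro ρ _ hρ
      by_contra h'
      exact hρ (by rw [if_neg h', mul_zero])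
  · refine Finset.sum_eq_zero fun ρ _ => ?_
    split_ifs with h₁ h₂
    · exact (hxy (h₁.trans h₂)).elim
    all_goals simp

open Classical in
theorem glueTop_matrix (d : Diagram n) (m : Movie a b) (σ : (d.tensor a).Coloring)
    (τ : (d.tensor b).Coloring) :
    (m.glueTop d).matrix σ τ = if σ.top = τ.top then m.matrix σ.bot τ.bot else 0 := by
  induction m with
  | nil =>
    simp only [glueTop, matrix, Matrix.one_apply, ← ite_and]
    refine if_congr ⟨?_, fun h => Coloring.ext_top_bot h.1 h.2⟩ rfl rfl
    rintro rfl
    exact ⟨rfl, rfl⟩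
  | snoc m s ih =>
    simp only [glueTop, matrix, Matrix.mul_apply, ih, Step.glueTop_matrix]
    refine sum_glue Coloring.top Coloring.bot (fun _ _ => Coloring.ext_top_bot) _ _
      (fun ρ => m.matrix σ.bot ρ) (fun ρ => s.matrix ρ τ.bot) fun ρ hρ => ?_
    exact Coloring.exists_paste _ _ (m.matrix_eq_of_ne_zero hρ).1

open Classical in
theorem glueBot_matrix (d : Diagram n) (m : Movie a b) (σ : (a.tensor d).Coloring)
    (τ : (b.tensor d).Coloring) :
    (m.glueBot d).matrix σ τ = if σ.bot = τ.bot then m.matrix σ.top τ.top else 0 := by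
  induction m with
  | nil =>
    simp only [glueBot, matrix, Matrix.one_apply, ← ite_and]
    refine if_congr ⟨?_, fun h => Coloring.ext_top_bot h.2 h.1⟩ rfl rfl
    rintro rfl
    exact ⟨rfl, rfl⟩
  | snoc m s ih =>
    simp only [glueBot, matrix, Matrix.mul_apply, ih, Step.glueBot_matrix]
    refine sum_glue Coloring.bot Coloring.top (fun _ _ h h' => Coloring.ext_top_bot h' h) _ _
      (fun ρ => m.matrix σ.top ρ) (fun ρ => s.matrix ρ τ.top) fun ρ hρ => ?_
    obtain ⟨κ, h₁, h₂⟩ := Coloring.exists_paste ρ σ.bot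
      fun j => ((m.matrix_eq_of_ne_zero hρ).2 j).symm
    exact ⟨κ, h₂, h₁⟩

end Movie

/-! ### The sphere and neck cutting relations in the state sum -/

namespace Diagram

variable {a : Diagram n}

open Classical in
/-- A colouring as a function on all pairs of numbers. -/
def Coloring.eval (σ : a.Coloring) (z : ℕ × ℕ) : Bool :=
  if h : z.1 ≤ a.word.length ∧ z.2 < width n (a.word.take z.1) then σ.1 ⟨z, h⟩ else false

theorem Coloring.eval_pt (σ : a.Coloring) (p : a.Pt) : σ.eval p.1 = σ.1 p := dif_pos p.2

theorem Coloring.eval_eq (σ : a.Coloring) {z z' : ℕ × ℕ} {l : ℕ} {L : Layer}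
    (hz : z.1 ≤ a.word.length ∧ z.2 < width n (a.word.take z.1))
    (hz' : z'.1 ≤ a.word.length ∧ z'.2 < width n (a.word.take z'.1))
    (hL : a.word[l]? = some L) (h : L.Joins l z z') : σ.eval z = σ.eval z' :=
  (σ.eval_pt ⟨z, hz⟩).trans
    ((σ.2 ⟨z, hz⟩ ⟨z', hz'⟩ ⟨l, L, hL, h⟩).trans (σ.eval_pt ⟨z', hz'⟩).symm)

end Diagram

theorem Step.colorWeight_eq_left {a b : Diagram n} (s : Step a b) {p : a.Pt}
    (h : ∀ A B, s.Meets A B ↔ A p) (σ : a.Pt → Bool) (τ : b.Pt → Bool) :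
    s.colorWeight σ τ = weight s.event.chi s.event.dots (σ p) := by
  simp [colorWeight, h]

theorem Step.colorWeight_eq_right {a b : Diagram n} (s : Step a b) {p : b.Pt}
    (h : ∀ A B, s.Meets A B ↔ B p) (σ : a.Pt → Bool) (τ : b.Pt → Bool) :
    s.colorWeight σ τ = weight s.event.chi s.event.dots (τ p) := by
  simp [colorWeight, h]

namespace CircleSite

variable (s : CircleSite n)

theorem length_out : s.out.word.length = s.u.length + s.v.length := List.length_append

theorem length_circ : s.circ.word.length = s.u.length + 2 + s.v.length := by
  simp [circ]; omega

theorem width_out {l : ℕ} (h : l ≤ s.u.length) :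
    width n (s.out.word.take l) = width n (s.u.take l) := by
  simp [out, List.take_append_of_le_length h]

theorem width_out_add (k : ℕ) :
    width n (s.out.word.take (s.u.length + k)) = width (width n s.u) (s.v.take k) := by
  simp [out, List.take_append, width_append, List.take_of_length_le]

theorem circ_word : s.circ.word = s.u ++ .cap s.i :: .cup s.i :: s.v := by simp [circ]

theorem width_circ {l : ℕ} (h : l ≤ s.u.length) :
    width n (s.circ.word.take l) = width n (s.u.take l) := by
  rw [circ_word, List.take_append_of_le_length h]

theorem width_circ_mid : width n (s.circ.word.take (s.u.length + 1)) = width n s.u + 2 := by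
  rw [circ_word]
  simp [List.take_append, width_append, List.take_of_length_le, width]

theorem width_circ_add (k : ℕ) :
    width n (s.circ.word.take (s.u.length + k + 2)) = width (width n s.u) (s.v.take k) := by
  rw [circ_word, show s.u.length + k + 2 = s.u.length + (k + 2) by omega]
  simp [List.take_append, width_append, List.take_of_length_le, width]

theorem le_width {m k i : ℕ} {u v : List Layer} (h : IsTangle m k (u ++ .cap i :: v)) :
    i ≤ width m u := by
  induction u generalizing m with
  | nil => exact h.1
  | cons L u ih => cases L <;> exact ih h.2

theorem i_le : s.i ≤ width n s.u := le_width (s.circ_word ▸ s.circ.isTangle)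

theorem getElem_out {l : ℕ} (h : l < s.u.length) : s.out.word[l]? = s.circ.word[l]? := by
  rw [circ_word, out, List.getElem?_append_left h, List.getElem?_append_left h]

theorem getElem_out_add {l : ℕ} (h : s.u.length ≤ l) : s.out.word[l]? = s.circ.word[l + 2]? := by
  rw [circ_word, out, List.getElem?_append_right h, List.getElem?_append_right (by omega),
    show l + 2 - s.u.length = l - s.u.length + 1 + 1 by omega]
  rfl

theorem getElem_cap : s.circ.word[s.u.length]? = some (.cap s.i) := by
  simp [circ_word]

theorem getElem_cup : s.circ.word[s.u.length + 1]? = some (.cup s.i) := by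
  simp [circ_word]

theorem shift_valid {z : ℕ × ℕ} (h : s.u.length ≤ z.1) :
    (z.1 + 2 ≤ s.circ.word.length ∧ z.2 < width n (s.circ.word.take (z.1 + 2))) ↔
      z.1 ≤ s.out.word.length ∧ z.2 < width n (s.out.word.take z.1) := by
  obtain ⟨l, j⟩ := z
  obtain ⟨k, rfl⟩ := Nat.exists_eq_add_of_le h
  simp only [width_circ_add, width_out_add, length_circ, length_out]
  omega

theorem same_valid {z : ℕ × ℕ} (h : z.1 ≤ s.u.length) :
    (z.1 ≤ s.circ.word.length ∧ z.2 < width n (s.circ.word.take z.1)) ↔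
      z.1 ≤ s.out.word.length ∧ z.2 < width n (s.out.word.take z.1) := by
  simp only [width_circ s h, width_out s h, length_circ, length_out]
  omega

/-- A point of the circle. -/
def circlePt : s.circ.Pt := ⟨(s.u.length + 1, s.i), by rw [length_circ]; simp only; omega, by
  have := s.i_le
  rw [width_circ_mid]; simp only; omega⟩

/-- A point in the lower part of the diagram, after the insertion of the circle. -/
def shiftPt (p : s.out.Pt) (h : s.u.length ≤ p.1.1) : s.circ.Pt :=
  ⟨(p.1.1 + 2, p.1.2), (s.shift_valid h).2 p.2⟩

/-- A point in the upper part of the diagram, after the insertion of the circle. -/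
def samePt (p : s.out.Pt) (h : p.1.1 ≤ s.u.length) : s.circ.Pt :=
  ⟨p.1, (s.same_valid h).2 p.2⟩

/-- A point of the diagram, after the insertion of the circle. -/
def embPt (p : s.out.Pt) : s.circ.Pt :=
  if h : p.1.1 ≤ s.u.length then s.samePt p h else s.shiftPt p (le_of_not_ge h)

variable {s}

/-- A strand passing the circle keeps its colour; on the line through the circle its position jumps
by two if it runs to the right. -/
theorem eval_mid (σ : s.circ.Coloring) {j : ℕ} (hj : j < width n s.u) :
    σ.eval (s.u.length, j) = σ.eval (s.u.length + 1, if j < s.i then j else j + 2) ∧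
      σ.eval (s.u.length + 1, if j < s.i then j else j + 2) = σ.eval (s.u.length + 2, j) := by
  have h₁ : s.u.length ≤ s.circ.word.length ∧ j < width n (s.circ.word.take s.u.length) := by
    rw [width_circ s le_rfl, List.take_length, length_circ]
    omega
  have h₂ : s.u.length + 1 ≤ s.circ.word.length ∧
      (if j < s.i then j else j + 2) < width n (s.circ.word.take (s.u.length + 1)) := by
    rw [width_circ_mid, length_circ]
    split_ifs <;> omega
  have h₃ : s.u.length + 2 ≤ s.circ.word.length ∧
      j < width n (s.circ.word.take (s.u.length + 2)) := by
    have := width_circ_add s 0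
    rw [Nat.add_zero] at this
    rw [this, length_circ]
    simpa [width] using hj
  refine ⟨σ.eval_eq h₁ h₂ s.getElem_cap ?_, σ.eval_eq h₂ h₃ s.getElem_cup ?_⟩
  · split_ifs with h
    · exact .cap_left _ _ h
    · exact .cap_right _ _ (not_lt.1 h)
  · split_ifs with h
    · exact .cup_left _ _ h
    · exact .cup_right _ _ (not_lt.1 h)

/-- The line at which the circle is inserted occurs twice afterwards, above and below it. `embPt`
picks the upper copy; colourings do not see the difference. -/
theorem shiftPt_eq (σ : s.circ.Coloring) (p : s.out.Pt) (h : s.u.length ≤ p.1.1) :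
    σ.1 (s.embPt p) = σ.1 (s.shiftPt p h) := by
  unfold embPt
  split_ifs with h'
  · have h₁ := p.2.2
    have h₂ : p.1.1 = s.u.length := le_antisymm h' h
    rw [h₂, width_out s le_rfl, List.take_length] at h₁
    rw [← σ.eval_pt, ← σ.eval_pt]
    have := eval_mid σ h₁
    rw [← h₂] at this
    exact this.1.trans this.2
  · rfl

theorem samePt_eq (σ : s.circ.Coloring) (p : s.out.Pt) (h : p.1.1 ≤ s.u.length) :
    σ.1 (s.embPt p) = σ.1 (s.samePt p h) := by
  rw [embPt, dif_pos h]

/-- The restriction of a colouring to the complement of the circle. -/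
def restrict (σ : s.circ.Coloring) : s.out.Coloring := ⟨fun p => σ.1 (s.embPt p), by
  rintro p q ⟨l, L, hL, h⟩
  obtain ⟨⟨h₁, h₂⟩, h₃, h₄⟩ := h.le
  change σ.1 (s.embPt p) = σ.1 (s.embPt q)
  rcases Nat.lt_or_ge l s.u.length with hl | hl
  · rw [samePt_eq σ p (by omega), samePt_eq σ q (by omega)]
    exact σ.2 _ _ ⟨l, L, by rw [← getElem_out s hl, hL], h⟩
  · rw [shiftPt_eq σ p (by omega), shiftPt_eq σ q (by omega)]
    refine σ.2 _ _ ⟨l + 2, L, by rw [← getElem_out_add s hl, hL], ?_⟩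
    have := h.shift 2
    simp only [add_comm 2] at this
    exact this⟩

/-- The colour of the circle. -/
def circleColor (σ : s.circ.Coloring) : Bool := σ.1 s.circlePt

theorem ext_circle {σ τ : s.circ.Coloring} (h : restrict σ = restrict τ)
    (h' : circleColor σ = circleColor τ) : σ = τ := by
  have h₀ : ∀ p, σ.1 (s.embPt p) = τ.1 (s.embPt p) := congrFun (congrArg Subtype.val h)
  have hsame : ∀ j < width n s.u, σ.eval (s.u.length, j) = τ.eval (s.u.length, j) := by
    intro j hj
    let p : s.out.Pt := ⟨(s.u.length, j), by rw [length_out]; simp only; omega, by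
      rw [width_out s le_rfl, List.take_length]; exact hj⟩
    have := h₀ p
    rw [samePt_eq σ p le_rfl, samePt_eq τ p le_rfl] at this
    rwa [← σ.eval_pt, ← τ.eval_pt] at this
  ext P
  by_cases h₁ : P.1.1 ≤ s.u.length
  · let p : s.out.Pt := ⟨P.1, (s.same_valid h₁).1 P.2⟩
    have := h₀ p
    rwa [samePt_eq σ p h₁, samePt_eq τ p h₁] at this
  by_cases h₂ : P.1.1 = s.u.length + 1
  · obtain ⟨⟨l, j⟩, hP₁, hP₂⟩ := P
    simp only at h₂
    subst h₂
    have hj := hP₂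
    simp only [width_circ_mid] at hj
    have hi := s.i_le
    by_cases hji : j = s.i
    · subst hji
      exact h'
    by_cases hji : j = s.i + 1
    · subst hji
      have key : s.circ.Joined s.circlePt ⟨(s.u.length + 1, s.i + 1), hP₁, hP₂⟩ :=
        ⟨_, _, s.getElem_cap, .cap_turn _⟩
      rw [← σ.2 _ _ key, ← τ.2 _ _ key]
      exact h'
    · rw [← σ.eval_pt, ← τ.eval_pt]
      -- All positions on this line other than `i` and `i + 1` belong to strands that pass the
      -- circle.
      obtain ⟨k, hk, rfl⟩ : ∃ k < width n s.u, j = if k < s.i then k else k + 2 := by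
        by_cases hlt : j < s.i
        · exact ⟨j, by omega, by rw [if_pos hlt]⟩
        · exact ⟨j - 2, by omega, by rw [if_neg (by omega)]; omega⟩
      rw [← (eval_mid σ hk).1, ← (eval_mid τ hk).1, hsame k hk]
  · obtain ⟨⟨l, j⟩, hP⟩ := P
    simp only at h₁ h₂
    obtain ⟨k, rfl⟩ : ∃ k, l = k + 2 := ⟨l - 2, by omega⟩
    have hk : s.u.length ≤ k := by omega
    let p : s.out.Pt := ⟨(k, j), (s.shift_valid (z := (k, j)) hk).1 hP⟩
    have := h₀ p
    rwa [shiftPt_eq σ p hk, shiftPt_eq τ p hk] at this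

theorem exists_restrict (σ : s.out.Coloring) (c : Bool) :
    ∃ τ : s.circ.Coloring, restrict τ = σ ∧ circleColor τ = c := by
  -- The line through the circle carries it at the positions `i` and `i + 1`; the colours of the
  -- other strands come from the line above. Everything further down has moved by two lines.
  let f : s.circ.Pt → Bool := fun P =>
    if P.1.1 ≤ s.u.length then σ.eval P.1
    else if P.1.1 = s.u.length + 1 then
      if P.1.2 < s.i then σ.eval (s.u.length, P.1.2)
      else if P.1.2 < s.i + 2 then c else σ.eval (s.u.length, P.1.2 - 2)
    else σ.eval (P.1.1 - 2, P.1.2)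
  have hf : ∀ P Q, s.circ.Joined P Q → f P = f Q := by
    rintro ⟨z, hz⟩ ⟨z', hz'⟩ ⟨l, L, hL, h⟩
    simp only at h
    obtain ⟨⟨h₁, h₂⟩, h₃, h₄⟩ := h.le
    rcases Nat.lt_or_ge l s.u.length with hl | hl
    · simp only [f, show z.1 ≤ s.u.length by omega, show z'.1 ≤ s.u.length by omega, if_true]
      exact σ.eval_eq ((s.same_valid (by omega)).1 hz) ((s.same_valid (by omega)).1 hz')
        (by rw [getElem_out s hl, hL]) h
    rcases hl.eq_or_lt with rfl | hl
    · rw [getElem_cap, Option.some.injEq] at hL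
      subst hL
      cases h with
      | cap_left _ _ h => simp [f, h]
      | cap_turn => simp [f]
      | cap_right _ j h => simp [f, show ¬ j + 2 < s.i by omega, show ¬ j < s.i by omega]
    rcases (Nat.succ_le_of_lt hl).eq_or_lt with rfl | hl
    · rw [Nat.succ_eq_add_one, getElem_cup, Option.some.injEq] at hL
      subst hL
      cases h with
      | cup_left _ _ h => simp [f, h]
      | cup_turn => simp [f]
      | cup_right _ j h => simp [f, show ¬ j + 2 < s.i by omega, show ¬ j < s.i by omega]
    · simp only [f, show ¬ z.1 ≤ s.u.length by omega, show ¬ z'.1 ≤ s.u.length by omega,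
        show ¬ z.1 = s.u.length + 1 by omega, show ¬ z'.1 = s.u.length + 1 by omega, if_false]
      obtain ⟨k, rfl⟩ : ∃ k, l = k + 2 := ⟨l - 2, by omega⟩
      obtain ⟨l₁, j₁⟩ := z
      obtain ⟨l₂, j₂⟩ := z'
      simp only at h₁ h₃ ⊢
      obtain ⟨k₁, rfl⟩ : ∃ k, l₁ = k + 2 := ⟨l₁ - 2, by omega⟩
      obtain ⟨k₂, rfl⟩ : ∃ k, l₂ = k + 2 := ⟨l₂ - 2, by omega⟩
      have hk : s.u.length ≤ k := by omega
      refine σ.eval_eq (l := k) (L := L)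
        ((s.shift_valid (z := (k₁, j₁)) (by simp only; omega)).1 hz)
        ((s.shift_valid (z := (k₂, j₂)) (by simp only; omega)).1 hz') ?_ ?_
      · rw [getElem_out_add s hk, hL]
      · rw [add_comm k 2] at h
        exact h.unshift
  refine ⟨⟨f, hf⟩, ?_, ?_⟩
  · ext p
    change f (s.embPt p) = _
    unfold embPt
    split_ifs with h
    · simp only [f, samePt, h, if_true]
      exact σ.eval_pt p
    · simp only [f, shiftPt, show ¬ p.1.1 + 2 ≤ s.u.length by omega,
        show ¬ p.1.1 + 2 = s.u.length + 1 by omega, if_false, Nat.add_sub_cancel]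
      exact σ.eval_pt p
  · simp [circleColor, f, circlePt]

/-- A colouring is given by the colour of the circle and a colouring of the rest. -/
def coloringEquiv : s.circ.Coloring ≃ s.out.Coloring × Bool :=
  Equiv.ofBijective (fun σ => (restrict σ, circleColor σ)) ⟨fun σ τ h => by
      simp only [Prod.mk.injEq] at h
      exact ext_circle h.1 h.2,
    fun x => by
      obtain ⟨τ, h, h'⟩ := exists_restrict x.1 x.2
      exact ⟨τ, Prod.ext h h'⟩⟩

theorem birth_matrix (σ : s.out.Coloring) (τ : s.circ.Coloring) :
    s.birth.matrix σ τ = if restrict τ = σ then diskValue (circleColor τ) else 0 := by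
  rw [birth, Movie.ofStep, Movie.matrix, Movie.matrix, Matrix.one_mul, Step.matrix]
  rw [Step.colorWeight_eq_right (p := s.circlePt)]
  · have key : restrict τ = σ ↔ ∀ p, τ.1 (s.embPt p) = σ.1 p := Subtype.ext_iff.trans funext_iff
    by_cases h : restrict τ = σ
    · rw [if_pos h, if_pos]
      · simp [weight, Event.chi, Event.dots, circleColor]
      · rintro p q ⟨h₁, ⟨h₂, h₃⟩ | ⟨r, h₂, h₃⟩⟩
        · rw [← key.1 h p, samePt_eq τ p h₃]
          exact congrArg _ (Subtype.ext (Prod.ext h₂ h₁))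
        · simp only [List.length_nil, List.length_cons] at h₂ h₃
          rw [← key.1 h p, shiftPt_eq τ p (by omega)]
          exact congrArg _ (Subtype.ext (Prod.ext (by simp only [shiftPt]; omega) h₁))
    · rw [if_neg h, if_neg]
      refine fun h' => h (key.2 fun p => (h' p _ ?_).symm)
      unfold embPt
      split_ifs with hp
      · exact ⟨rfl, .inl ⟨rfl, hp⟩⟩
      · refine ⟨rfl, .inr ⟨p.1.1 - s.u.length, ?_⟩⟩
        simp only [shiftPt, List.length_nil, List.length_cons]
        omega
  · intro A B
    constructor
    · rintro ⟨q, hq, h⟩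
      rwa [show s.circlePt = q from Subtype.ext hq.symm]
    · exact fun h => ⟨_, rfl, h⟩

theorem death_matrix (τ : s.circ.Coloring) (σ : s.out.Coloring) :
    s.death.matrix τ σ = if restrict τ = σ then diskValue (circleColor τ) else 0 := by
  rw [death, Movie.ofStep, Movie.matrix, Movie.matrix, Matrix.one_mul, Step.matrix]
  rw [Step.colorWeight_eq_left (p := s.circlePt)]
  · have key : restrict τ = σ ↔ ∀ p, τ.1 (s.embPt p) = σ.1 p := Subtype.ext_iff.trans funext_iff
    by_cases h : restrict τ = σ
    · rw [if_pos h, if_pos]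
      · simp [weight, Event.chi, Event.dots, circleColor]
      · rintro q p ⟨h₁, ⟨h₂, h₃⟩ | ⟨r, h₃, h₂⟩⟩
        · simp only at h₃
          rw [← key.1 h p, samePt_eq τ p (by omega)]
          exact congrArg _ (Subtype.ext (Prod.ext h₂ h₁))
        · simp only [List.length_nil, List.length_cons] at h₂ h₃
          rw [← key.1 h p, shiftPt_eq τ p (by omega)]
          exact congrArg _ (Subtype.ext (Prod.ext (by simp only [shiftPt]; omega) h₁))
    · rw [if_neg h, if_neg]
      refine fun h' => h (key.2 fun p => h' _ p ?_)
      unfold embPt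
      split_ifs with hp
      · exact ⟨rfl, .inl ⟨rfl, hp⟩⟩
      · refine ⟨rfl, .inr ⟨p.1.1 - s.u.length, ?_⟩⟩
        simp only [shiftPt, List.length_nil, List.length_cons]
        omega
  · intro A B
    constructor
    · rintro ⟨q, hq, h⟩
      rwa [show s.circlePt = q from Subtype.ext hq.symm]
    · exact fun h => ⟨_, rfl, h⟩

theorem dot_matrix : s.dot.matrix = Matrix.diagonal fun τ => dotValue (circleColor τ) := by
  ext σ τ
  rw [dot, Movie.ofStep, Movie.matrix, Movie.matrix, Matrix.one_mul, Step.matrix]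
  rw [Step.colorWeight_eq_left (p := s.circlePt)]
  · by_cases h : σ = τ
    · subst h
      rw [if_pos, Matrix.diagonal_apply_eq]
      · simp [weight, Event.chi, Event.dots, circleColor]
      · rintro p q ⟨h₁, h₂⟩
        refine congrArg _ (Subtype.ext (Prod.ext ?_ h₁))
        rcases h₂ with ⟨h₂, -⟩ | ⟨r, h₂, h₃⟩
        · exact h₂
        · exact h₂.trans h₃.symm
    · rw [if_neg, Matrix.diagonal_apply_ne _ h]
      refine fun h' => h (Subtype.ext (funext fun p => h' p p ⟨rfl, ?_⟩))
      simp only [List.length_nil, Nat.add_zero, true_and, and_self]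
      exact (le_total p.1.1 _).imp id Nat.exists_eq_add_of_le
  · intro A B
    constructor
    · rintro ⟨q, hq, h⟩
      rwa [show s.circlePt = q from Subtype.ext (by simpa [circlePt] using hq.symm)]
    · exact fun h => ⟨_, by simp [circlePt], h⟩

/-- The colour of the closed sphere is summed out independently of the rest, leaving a scalar; `f`
stands for decorations such as powers of the dot. -/
theorem birth_mul_death (f : Bool → ZMod 17) :
    s.birth.matrix * ((Matrix.diagonal fun τ => f (circleColor τ) :
        Matrix s.circ.Coloring s.circ.Coloring (ZMod 17)) * s.death.matrix) =
      (∑ c, diskValue c * (f c * diskValue c)) • (1 : Matrix _ _ (ZMod 17)) := by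
  ext σ σ'
  rw [Matrix.mul_apply]
  simp only [Matrix.diagonal_mul, birth_matrix, death_matrix]
  refine (Fintype.sum_equiv (coloringEquiv (s := s)) _ (fun x : s.out.Coloring × Bool =>
    (if x.1 = σ then diskValue x.2 else 0) * (f x.2 * if x.1 = σ' then diskValue x.2 else 0))
    fun τ => rfl).trans ?_
  rw [Fintype.sum_prod_type_right]
  by_cases h : σ = σ'
  · simp [h]
  · simp [h, Ne.symm h]

theorem neck_matrix : s.death.matrix * (s.birth.matrix * s.dot.matrix) +
    s.dot.matrix * (s.death.matrix * s.birth.matrix) = 1 := by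
  ext τ τ'
  -- The left side is `d_c d_c' (x_c + x_c')`. For different colours the dot eigenvalues cancel; for
  -- equal ones it is `2 x_c d_c² = 1`, because `d_c² = ±1/2` has the sign of `x_c`.
  have h (c c' : Bool) : diskValue c * (diskValue c' * dotValue c') +
      dotValue c * (diskValue c * diskValue c') = if c = c' then 1 else 0 := by
    revert c c'; decide
  rw [Matrix.add_apply, dot_matrix, Matrix.diagonal_mul, Matrix.mul_apply, Matrix.mul_apply]
  simp only [Matrix.mul_diagonal, birth_matrix, death_matrix, ite_mul, mul_ite, zero_mul, mul_zero,
    Finset.sum_ite_eq, Finset.mem_univ, if_true]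
  by_cases hr : restrict τ = restrict τ'
  · simp only [hr, if_true, h, Matrix.one_apply]
    exact if_congr ⟨fun h => ext_circle hr h, fun h => congrArg _ h⟩ rfl rfl
  · rw [if_neg hr, if_neg hr, Matrix.one_apply_ne]
    · simp
    · rintro rfl
      exact hr rfl

end CircleSite

/-! ### The state sum on `Cob n` -/

/-- The homomorphism `ℤ[α] → 𝔽₁₇` that sends `α` to `1`. -/
def scalar : R →+* ZMod 17 := Polynomial.eval₂RingHom (Int.castRingHom (ZMod 17)) 1

theorem scalar_alpha : scalar alpha = 1 := by simp [scalar]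

section

variable {a b c : Diagram n}

/-- The matrix of a linear combination of movies. -/
def linMatrix : (Movie a b →₀ R) →+ Matrix a.Coloring b.Coloring (ZMod 17) :=
  Finsupp.liftAddHom fun m =>
    AddMonoidHom.mk' (fun r : R => scalar r • m.matrix) fun r r' => by rw [map_add, add_smul]

theorem linMatrix_single (m : Movie a b) (r : R) :
    linMatrix (Finsupp.single m r) = scalar r • m.matrix :=
  Finsupp.liftAddHom_apply_single _ m r

theorem linMatrix_single_one (m : Movie a b) : linMatrix (Finsupp.single m (1 : R)) = m.matrix := by
  rw [linMatrix_single, map_one, one_smul]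

theorem linMatrix_smul (r : R) (f : Movie a b →₀ R) :
    linMatrix (r • f) = scalar r • linMatrix f := by
  induction f using Finsupp.induction_linear with
  | zero => rw [smul_zero, map_zero, smul_zero]
  | add f g hf hg => rw [smul_add, map_add, map_add, hf, hg, smul_add]
  | single m r' => rw [Finsupp.smul_single, linMatrix_single, linMatrix_single, smul_eq_mul,
      map_mul, mul_smul]

theorem linMatrix_comp (f : Movie a b →₀ R) (g : Movie b c →₀ R) :
    linMatrix (f.sum fun m r => g.sum fun m' r' => Finsupp.single (m.comp m') (r * r')) =
      linMatrix f * linMatrix g := by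
  induction f using Finsupp.induction_linear with
  | zero => simp
  | add f f' hf hf' =>
    rw [Finsupp.sum_add_index', map_add, map_add, hf, hf', Matrix.add_mul]
    · simp
    · intro m r r'
      rw [← Finsupp.sum_add]
      simp only [add_mul, Finsupp.single_add]
  | single m r =>
    rw [Finsupp.sum_single_index (by simp)]
    induction g using Finsupp.induction_linear with
    | zero => simp
    | add f f' hf hf' =>
      rw [Finsupp.sum_add_index', map_add, map_add, hf, hf', Matrix.mul_add]
      · simp
      · simp [mul_add]
    | single m' r' =>
      rw [Finsupp.sum_single_index (by simp), linMatrix_single, linMatrix_single, linMatrix_single,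
        Movie.matrix_comp, map_mul, Matrix.smul_mul, Matrix.mul_smul, mul_smul]

theorem linMatrix_glueTop (d : Diagram n) (f : Movie a b →₀ R) (σ : (d.tensor a).Coloring)
    (τ : (d.tensor b).Coloring) :
    linMatrix (f.sum fun m r => r • Finsupp.single (m.glueTop d) (1 : R)) σ τ =
      if σ.top = τ.top then linMatrix f σ.bot τ.bot else 0 := by
  induction f using Finsupp.induction_linear with
  | zero => simp
  | add f g hf hg =>
    rw [Finsupp.sum_add_index', map_add, map_add, Matrix.add_apply, hf, hg, Matrix.add_apply]
    · split_ifs <;> simp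
    · simp
    · exact fun _ _ _ => add_smul _ _ _
  | single m r =>
    rw [Finsupp.sum_single_index (by simp), linMatrix_smul, linMatrix_single_one,
      linMatrix_single, Matrix.smul_apply, Matrix.smul_apply, m.glueTop_matrix, smul_ite, smul_zero]

theorem linMatrix_glueBot (d : Diagram n) (f : Movie a b →₀ R) (σ : (a.tensor d).Coloring)
    (τ : (b.tensor d).Coloring) :
    linMatrix (f.sum fun m r => r • Finsupp.single (m.glueBot d) (1 : R)) σ τ =
      if σ.bot = τ.bot then linMatrix f σ.top τ.top else 0 := by
  induction f using Finsupp.induction_linear with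
  | zero => simp
  | add f g hf hg =>
    rw [Finsupp.sum_add_index', map_add, map_add, Matrix.add_apply, hf, hg, Matrix.add_apply]
    · split_ifs <;> simp
    · simp
    · exact fun _ _ _ => add_smul _ _ _
  | single m r =>
    rw [Finsupp.sum_single_index (by simp), linMatrix_smul, linMatrix_single_one,
      linMatrix_single, Matrix.smul_apply, Matrix.smul_apply, m.glueBot_matrix, smul_ite, smul_zero]

/-- The vertical sides of every movie preserve the colours of the end points, and this survives
linear combinations. -/
theorem linMatrix_eq_zero (f : Movie a b →₀ R) (σ : a.Coloring) (τ : b.Coloring) {j : Fin n}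
    (h : σ.1 (a.firstPt j) ≠ τ.1 (b.firstPt j)) : linMatrix f σ τ = 0 := by
  induction f using Finsupp.induction_linear with
  | zero => simp
  | add f g hf hg => rw [map_add, Matrix.add_apply, hf, hg, add_zero]
  | single m r =>
    rw [linMatrix_single, Matrix.smul_apply]
    by_contra h'
    exact h ((m.matrix_eq_of_ne_zero (right_ne_zero_of_smul h')).1 j)

end

/-- The value is `ε(x^k) = 1/2 + (-1)^k (-1/2)`. The cases `k = 0, 1, 2, 3` are the four sphere
relations with `α = 1`. -/
theorem CircleSite.sphere_matrix (s : CircleSite n) (k : ℕ) :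
    s.birth.matrix * ((Matrix.diagonal fun τ => dotValue (circleColor τ) ^ k :
        Matrix s.circ.Coloring s.circ.Coloring (ZMod 17)) * s.death.matrix) =
      (if Odd k then (1 : ZMod 17) else 0) • (1 : Matrix _ _ (ZMod 17)) := by
  rw [birth_mul_death (fun c => dotValue c ^ k), Fintype.sum_bool]
  congr 1
  rcases Nat.even_or_odd k with h | h
  · simp only [dotValue, diskValue, if_true, Bool.false_eq_true, if_false, one_pow, h.neg_one_pow,
      if_neg (Nat.not_odd_iff_even.2 h)]
    decide
  · simp only [dotValue, diskValue, if_true, Bool.false_eq_true, if_false, one_pow, h.neg_one_pow,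
      if_pos h]
    decide

theorem CircleSite.sphere_dot_matrix (s : CircleSite n) :
    (s.birth.comp (s.dot.comp s.death)).matrix = 1 := by
  have := s.sphere_matrix 1
  simp only [Movie.matrix_comp, dot_matrix]
  simpa using this

theorem CircleSite.sphere_dot_dot_matrix (s : CircleSite n) :
    (s.birth.comp (s.dot.comp (s.dot.comp s.death))).matrix = 0 := by
  have := s.sphere_matrix 2
  simp only [Movie.matrix_comp, dot_matrix]
  rw [← Matrix.mul_assoc (Matrix.diagonal _), Matrix.diagonal_mul_diagonal]
  simpa [pow_two, show ¬ Odd 2 by decide] using this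

theorem CircleSite.sphere_dot_dot_dot_matrix (s : CircleSite n) :
    (s.birth.comp (s.dot.comp (s.dot.comp (s.dot.comp s.death)))).matrix = 1 := by
  have := s.sphere_matrix 3
  simp only [Movie.matrix_comp, dot_matrix]
  rw [← Matrix.mul_assoc (Matrix.diagonal _), Matrix.diagonal_mul_diagonal,
    ← Matrix.mul_assoc (Matrix.diagonal _), Matrix.diagonal_mul_diagonal]
  simpa [pow_succ, show Odd 3 by decide, mul_assoc] using this

theorem CircleSite.linMatrix_neck (s : CircleSite n) :
    linMatrix (Finsupp.single (.nil : Movie s.circ s.circ) 1) =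
      linMatrix (Finsupp.single (s.death.comp (s.birth.comp s.dot)) 1 +
        Finsupp.single (s.dot.comp (s.death.comp s.birth)) 1) := by
  rw [map_add]
  simp only [linMatrix_single_one, Movie.matrix_comp, neck_matrix]
  rfl

/-- The matrix of a morphism of `PreCob n`. -/
def homMatrix {X Y : PreCob n} (f : X ⟶ Y) :
    Matrix (GradedDiagram.diagram X).Coloring (GradedDiagram.diagram Y).Coloring (ZMod 17) :=
  linMatrix (show Movie (GradedDiagram.diagram X) (GradedDiagram.diagram Y) →₀ R from f)

theorem homMatrix_comp {X Y Z : PreCob n} (f : X ⟶ Y) (g : Y ⟶ Z) :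
    homMatrix (f ≫ g) = homMatrix f * homMatrix g := linMatrix_comp _ _

/-- The matrices respect the relations of `Cob n`. -/
theorem Rel.homMatrix_eq {X Y : PreCob n} {f g : X ⟶ Y} (h : Rel n f g) :
    homMatrix f = homMatrix g := by
  induction h with
  | equivalent p q m m' h =>
    change linMatrix (Finsupp.single m 1) = linMatrix (Finsupp.single m' 1)
    rw [linMatrix_single_one, linMatrix_single_one, h.matrix_eq]
  | sphere s p q =>
    have := s.sphere_matrix 0
    change linMatrix (Finsupp.single (s.birth.comp s.death) 1) = linMatrix 0
    rw [linMatrix_single_one, map_zero, Movie.matrix_comp]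
    simpa using this
  | sphere_dot s p q =>
    exact (linMatrix_single_one _).trans
      (s.sphere_dot_matrix.trans (linMatrix_single_one .nil).symm)
  | sphere_dot_dot s p q =>
    exact (linMatrix_single_one _).trans (s.sphere_dot_dot_matrix.trans (map_zero linMatrix).symm)
  | sphere_dot_dot_dot s p q =>
    refine (linMatrix_single_one _).trans (s.sphere_dot_dot_dot_matrix.trans ?_)
    refine Eq.trans ?_ (linMatrix_smul alpha _).symm
    rw [scalar_alpha, one_smul]
    exact (linMatrix_single_one .nil).symm
  | neck s p q => exact s.linMatrix_neck
  | refl f => rfl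
  | symm _ ih => exact ih.symm
  | trans _ _ ih ih' => exact ih.trans ih'
  | add _ _ ih ih' =>
    exact (map_add linMatrix _ _).trans ((congrArg₂ (· + ·) ih ih').trans
      (map_add linMatrix _ _).symm)
  | smul r _ ih =>
    exact (linMatrix_smul r _).trans ((congrArg (scalar r • ·) ih).trans
      (linMatrix_smul r _).symm)
  | comp_left f _ ih => rw [homMatrix_comp, homMatrix_comp, ih]
  | comp_right g _ ih => rw [homMatrix_comp, homMatrix_comp, ih]
  | glueTop D _ ih =>
    refine Matrix.ext fun σ τ => (linMatrix_glueTop _ _ σ τ).trans (Eq.trans ?_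
      (linMatrix_glueTop _ _ σ τ).symm)
    exact if_congr Iff.rfl (congrFun (congrFun ih _) _) rfl
  | glueBot D _ ih =>
    refine Matrix.ext fun σ τ => (linMatrix_glueBot _ _ σ τ).trans (Eq.trans ?_
      (linMatrix_glueBot _ _ σ τ).symm)
    exact if_congr Iff.rfl (congrFun (congrFun ih _) _) rfl

/-! ### The obstruction to a retraction of `e₁` onto the identity diagram -/

theorem e₁_firstPt (τ : e₁.Coloring) : τ.1 (e₁.firstPt 0) = τ.1 (e₁.firstPt 1) :=
  τ.2 _ _ ⟨0, .cup 0, rfl, .cup_turn 0⟩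

theorem linMatrix_comp_ne_one (f : Movie (one 2) e₁ →₀ R) (g : Movie e₁ (one 2) →₀ R) :
    linMatrix f * linMatrix g ≠ 1 := by
  intro h
  -- The two strands of the identity diagram are not connected, so they may receive different
  -- colours.
  let σ : (one 2).Coloring := ⟨fun p => p.1.2 == 0, by
    rintro p q ⟨l, L, hL, -⟩
    simp [one] at hL⟩
  have h₃ : (linMatrix f * linMatrix g) σ σ = 0 := by
    rw [Matrix.mul_apply]
    refine Finset.sum_eq_zero fun τ _ => ?_
    have hτ := e₁_firstPt τ
    -- The common colour of the top arc under `τ` clashes with one of the two strands: with the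
    -- second if it is `true`, with the first otherwise.
    by_cases h0 : τ.1 (e₁.firstPt 0) = true
    · rw [linMatrix_eq_zero f σ τ (j := 1), zero_mul]
      change ((1 : ℕ) == 0) ≠ τ.1 (e₁.firstPt 1)
      rw [← hτ, h0]
      decide
    · rw [linMatrix_eq_zero f σ τ (j := 0), zero_mul]
      exact fun h' => h0 (h'.symm.trans rfl)
  rw [h, Matrix.one_apply_eq] at h₃
  exact one_ne_zero h₃

/-- The identity diagram is not a retract of `e₁`. -/
theorem comp_ne_id (p q : ℤ) (f : Cob.obj (one 2) p ⟶ Cob.obj e₁ q)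
    (g : Cob.obj e₁ q ⟶ Cob.obj (one 2) p) : f ≫ g ≠ 𝟙 _ := by
  obtain ⟨f, rfl⟩ := (Quotient.functor (rel 2)).map_surjective f
  obtain ⟨g, rfl⟩ := (Quotient.functor (rel 2)).map_surjective g
  intro h
  -- Since `rel 2` is already a congruence, equality in the quotient gives back a derivation by
  -- `Rel`, to which the matrix invariant applies.
  have h₁ : (Quotient.functor (rel 2)).map (f ≫ g) =
      (Quotient.functor (rel 2)).map (𝟙 (Free.of R (⟨one 2, p⟩ : GradedDiagram 2))) :=
    ((Quotient.functor (rel 2)).map_comp f g).trans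
      (h.trans ((Quotient.functor (rel 2)).map_id _).symm)
  have h₂ : homMatrix (f ≫ g) = homMatrix (𝟙 (Free.of R (⟨one 2, p⟩ : GradedDiagram 2))) :=
    Rel.homMatrix_eq ((Quotient.functor_map_eq_iff (rel 2) _ _).1 h₁)
  rw [homMatrix_comp] at h₂
  exact linMatrix_comp_ne_one _ _ (h₂.trans (linMatrix_single_one _))

/-! ### Equivalences of movies -/

namespace Movie

variable {a b : Diagram n}

theorem component_eq {m : Movie a b} {p q : m.Pt} (h : m.Joined p q) :
    m.component p = m.component q := Quot.sound h

/-- Two movies are equivalent if there are maps between their surfaces, inverse to each other on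
the components, that are compatible with all the data. -/
theorem Equivalent.of_maps {m m' : Movie a b} (F : m.Pt → m'.Pt) (G : m'.Pt → m.Pt)
    (hF : ∀ p q, m.Joined p q → m'.component (F p) = m'.component (F q))
    (hG : ∀ p q, m'.Joined p q → m.component (G p) = m.component (G q))
    (hGF : ∀ p, m.component (G (F p)) = m.component p)
    (hFG : ∀ p, m'.component (F (G p)) = m'.component p)
    (hfirst : ∀ p, m'.component (F (m.first p)) = m'.component (m'.first p))
    (hlast : ∀ p, m'.component (F (m.last p)) = m'.component (m'.last p))
    (hchi : ∀ c, m.chi (fun p => m'.component (F p) = c) = m'.chi fun p => m'.component p = c)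
    (hdots : ∀ c, m.dots (fun p => m'.component (F p) = c) = m'.dots fun p => m'.component p = c) :
    m.Equivalent m' := by
  let φ : m.Component ≃ m'.Component :=
    { toFun := Quot.lift (fun p => m'.component (F p)) hF
      invFun := Quot.lift (fun p => m.component (G p)) hG
      left_inv := fun c => by induction c using Quot.ind; exact hGF _
      right_inv := fun c => by induction c using Quot.ind; exact hFG _ }
  have hφ : ∀ c, (fun p => m.component p = c) = fun p => m'.component (F p) = φ c := by
    intro c
    funext p
    exact propext φ.injective.eq_iff.symm
  refine ⟨φ, hfirst, hlast, fun c => ?_, fun c => ?_⟩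
  · exact (congrArg m.chi (hφ c)).trans (hchi _)
  · exact (congrArg m.dots (hφ c)).trans (hdots _)

open Classical in
theorem chi_two {c : Diagram n} (s : Step a b) (t : Step b c)
    (S : (((nil : Movie a a).snoc s).snoc t).Pt → Prop) :
    (((nil : Movie a a).snoc s).snoc t).chi S =
      (if s.Meets (fun p => S (.inl (.inl p))) (fun p => S (.inl (.inr p)))
        then s.event.chi else 0) +
      if t.Meets (fun p => S (.inl (.inr p))) (fun p => S (.inr p)) then t.event.chi else 0 :=
  congrArg (· + _) (zero_add _)

open Classical in
theorem dots_two {c : Diagram n} (s : Step a b) (t : Step b c)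
    (S : (((nil : Movie a a).snoc s).snoc t).Pt → Prop) :
    (((nil : Movie a a).snoc s).snoc t).dots S =
      (if s.Meets (fun p => S (.inl (.inl p))) (fun p => S (.inl (.inr p)))
        then s.event.dots else 0) +
      if t.Meets (fun p => S (.inl (.inr p))) (fun p => S (.inr p)) then t.event.dots else 0 :=
  congrArg (· + _) (zero_add _)

end Movie

/-! ### Sliding dots -/

/-- A dot in a point of the diagram. -/
def dotStep (a : Diagram n) (p : a.Pt) : Step a a where
  u := a.word.take p.1.1
  v := a.word.drop p.1.1
  x := []
  y := []
  event := .dot p.1.2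
  src := by simp
  tgt := by simp
  valid := p.2.2

theorem Step.meets_inl {a b : Diagram n} (s : Step a b) {z : ℕ × ℕ} (h : s.event.site = .inl z)
    (p : a.Pt) (hp : p.1 = (s.u.length + z.1, z.2)) (A : a.Pt → Prop) (B : b.Pt → Prop) :
    s.Meets A B ↔ A p := by
  unfold Meets
  rw [h]
  constructor
  · rintro ⟨p', hp', hA⟩
    rwa [Subtype.ext (hp.trans hp'.symm)]
  · exact fun hA => ⟨p, hp, hA⟩

section

variable {a b : Diagram n}

theorem dotStep_matches (p q r : a.Pt) : (dotStep a p).Matches q r ↔ q = r := by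
  constructor
  · rintro ⟨h, ⟨h', -⟩ | ⟨k, h', h''⟩⟩
    · exact Subtype.ext (Prod.ext h' h)
    · exact Subtype.ext (Prod.ext (h'.trans h''.symm) h)
  · rintro rfl
    refine ⟨rfl, ?_⟩
    rcases le_total q.1.1 (dotStep a p).u.length with h | h
    · exact .inl ⟨rfl, h⟩
    · obtain ⟨k, hk⟩ := Nat.exists_eq_add_of_le h
      exact .inr ⟨k, hk, hk⟩

theorem dotStep_meets (p : a.Pt) (A B : a.Pt → Prop) : (dotStep a p).Meets A B ↔ A p := by
  refine (dotStep a p).meets_inl rfl p ?_ A B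
  have := p.2.1
  simp only [dotStep, List.length_take, Nat.add_zero]
  rw [min_eq_left this]

open Classical in
theorem chi_snoc_dotStep (m : Movie a b) (p : b.Pt) (S : (m.snoc (dotStep b p)).Pt → Prop) :
    (m.snoc (dotStep b p)).chi S = m.chi fun x => S (.inl x) :=
  (congrArg (_ + ·) (ite_self (0 : ℤ))).trans (add_zero _)

open Classical in
theorem dots_snoc_dotStep (m : Movie a b) (p : b.Pt) (S : (m.snoc (dotStep b p)).Pt → Prop) :
    (m.snoc (dotStep b p)).dots S =
      (m.dots fun x => S (.inl x)) + if S (.inl (m.last p)) then 1 else 0 :=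
  congrArg (_ + ·) (if_congr (dotStep_meets _ _ _) rfl rfl)

open Classical in
/-- A dot can be moved within a component. -/
theorem equivalent_dot_move (m : Movie a b) {p q : b.Pt}
    (h : m.component (m.last p) = m.component (m.last q)) :
    (m.snoc (dotStep b p)).Equivalent (m.snoc (dotStep b q)) := by
  have hJ : ∀ x y, (m.snoc (dotStep b p)).Joined x y ↔ (m.snoc (dotStep b q)).Joined x y := by
    rintro (x | x) (y | y)
    · exact Iff.rfl
    · simp only [Movie.Joined, dotStep_matches]
    · exact Iff.rfl
    · exact Iff.rfl
  have hc : ∀ x y, m.component x = m.component y →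
      (m.snoc (dotStep b q)).component (.inl x) = (m.snoc (dotStep b q)).component (.inl y) := by
    intro x y hxy
    let f : m.Component → (m.snoc (dotStep b q)).Component := Quot.map Sum.inl fun _ _ h => h
    exact congrArg f hxy
  refine .of_maps id id (fun x y hxy => Movie.component_eq ((hJ x y).1 hxy))
    (fun x y hxy => Movie.component_eq ((hJ x y).2 hxy)) (fun _ => rfl) (fun _ => rfl)
    (fun _ => rfl) (fun _ => rfl) (fun c => ?_) (fun c => ?_)
  · rw [chi_snoc_dotStep, chi_snoc_dotStep]
    rfl
  · rw [dots_snoc_dotStep, dots_snoc_dotStep]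
    refine congrArg (_ + ·) (if_congr ?_ rfl rfl)
    exact Eq.congr (hc _ _ h) rfl

open Classical in
/-- A dot commutes with a change of the diagram elsewhere. -/
theorem equivalent_dot_comm (s : Step a b) {p : a.Pt} {q : b.Pt} (h : s.Matches p q) :
    (((Movie.nil : Movie a a).snoc (dotStep a p)).snoc s).Equivalent
      (((Movie.nil : Movie a a).snoc s).snoc (dotStep b q)) := by
  let m : Movie a b := ((Movie.nil : Movie a a).snoc (dotStep a p)).snoc s
  let m' : Movie a b := ((Movie.nil : Movie a a).snoc s).snoc (dotStep b q)
  let F : m.Pt → m'.Pt := fun x => match x with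
    | .inl (.inl x) => .inl (.inl x)
    | .inl (.inr x) => .inl (.inl x)
    | .inr y => .inr y
  let G : m'.Pt → m.Pt := fun x => match x with
    | .inl (.inl x) => .inl (.inl x)
    | .inl (.inr y) => .inr y
    | .inr y => .inr y
  have h₁ : ∀ x : a.Pt, m.component (.inl (.inl x)) = m.component (.inl (.inr x)) := fun x =>
    Movie.component_eq (m := m) ⟨x, rfl, (dotStep_matches _ _ _).2 rfl⟩
  have h₂ : ∀ x y, s.Matches x y → m.component (.inl (.inr x)) = m.component (.inr y) :=
    fun x y hxy => Movie.component_eq (m := m) ⟨x, rfl, hxy⟩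
  have h₁' : ∀ y : b.Pt, m'.component (.inl (.inr y)) = m'.component (.inr y) := fun x =>
    Movie.component_eq (m := m') ⟨x, rfl, (dotStep_matches _ _ _).2 rfl⟩
  have h₂' : ∀ x y, s.Matches x y → m'.component (.inl (.inl x)) = m'.component (.inl (.inr y)) :=
    fun x y hxy => Movie.component_eq (m := m') ⟨x, rfl, hxy⟩
  refine Movie.Equivalent.of_maps (m := m) (m' := m') F G ?_ ?_ ?_ ?_ ?_ ?_ ?_ ?_
  · rintro ((x | x) | x) ((y | y) | y) hxy
    · exact Movie.component_eq (m := m') hxy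
    · obtain ⟨r, rfl, hr⟩ := hxy
      rw [dotStep_matches] at hr
      rw [hr]
      rfl
    · obtain ⟨r, hr, -⟩ := hxy
      cases hr
    · exact hxy.elim
    · exact Movie.component_eq (m := m') (p := .inl (.inl x)) (q := .inl (.inl y)) hxy
    · obtain ⟨r, hr, hr'⟩ := hxy
      cases hr
      exact (h₂' _ _ hr').trans (h₁' _)
    · exact hxy.elim
    · exact hxy.elim
    · exact Movie.component_eq (m := m') hxy
  · rintro ((x | x) | x) ((y | y) | y) hxy
    · exact Movie.component_eq (m := m) hxy
    · obtain ⟨r, rfl, hr⟩ := hxy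
      exact (h₁ r).trans (h₂ _ _ hr)
    · obtain ⟨r, hr, -⟩ := hxy
      cases hr
    · exact hxy.elim
    · exact Movie.component_eq (m := m) (p := .inr x) (q := .inr y) hxy
    · obtain ⟨r, hr, hr'⟩ := hxy
      cases hr
      rw [dotStep_matches] at hr'
      rw [hr']
    · exact hxy.elim
    · exact hxy.elim
    · exact Movie.component_eq (m := m) hxy
  · rintro ((x | x) | x)
    · rfl
    · exact h₁ x
    · rfl
  · rintro ((x | x) | x)
    · rfl
    · exact (h₁' x).symm
    · rfl
  · exact fun _ => rfl
  · exact fun _ => rfl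
  · intro c
    have e : (fun y : b.Pt => m'.component (.inl (.inr y)) = c) =
        fun y => m'.component (.inr y) = c := by
      funext y; rw [h₁']
    refine (Movie.chi_two _ _ _).trans (Eq.trans ?_ (chi_snoc_dotStep _ _ _).symm)
    refine (congrArg (· + _) (ite_self (0 : ℤ))).trans ?_
    refine congrArg₂ (· + ·) rfl (if_congr ?_ rfl rfl)
    exact iff_of_eq (congrArg (s.Meets _) e.symm)
  · intro c
    have e : (fun y : b.Pt => m'.component (.inl (.inr y)) = c) =
        fun y => m'.component (.inr y) = c := by
      funext y; rw [h₁']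
    refine (Movie.dots_two _ _ _).trans (Eq.trans ?_ (dots_snoc_dotStep _ _ _).symm)
    rw [add_comm]
    refine congrArg₂ (· + ·) ((if_congr ?_ rfl rfl).trans (zero_add _).symm) (if_congr ?_ rfl rfl)
    · exact iff_of_eq (congrArg (s.Meets _) e.symm)
    · exact (dotStep_meets _ _ _).trans (Eq.congr (h₂' _ _ h) rfl)

end

/-! ### Movies between `e₁` and `e₁ ⊗ e₁` -/

/-- The middle of `e₁`. -/
def midSite : CircleSite 2 := ⟨[.cup 0], [.cap 0], 0, e₁.isTangle, (e₁.tensor e₁).isTangle⟩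

/-- The saddle at the top of `e₁`. -/
def saddleTop : Step e₁ (e₁.tensor e₁) :=
  ⟨[], e₁.word, [], _, .saddle 0, rfl, rfl, trivial⟩

/-- The saddle at the bottom of `e₁`. -/
def saddleBot : Step e₁ (e₁.tensor e₁) :=
  ⟨e₁.word, [], [], _, .saddle 0, rfl, rfl, trivial⟩

/-- The circle of `e₁ ⊗ e₁` dies. -/
def deathStep : Step (e₁.tensor e₁) e₁ :=
  ⟨[.cup 0], [.cap 0], _, [], .death 0, rfl, rfl, trivial⟩

/-- A circle is born in the middle of `e₁`. -/
def birthStep : Step e₁ (e₁.tensor e₁) :=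
  ⟨[.cup 0], [.cap 0], [], _, .birth 0, rfl, rfl, trivial⟩

/-- The left end point of the top arc of `e₁`. -/
def topPoint : e₁.Pt := ⟨(0, 0), by decide, by decide⟩

/-- The left end point of the bottom arc of `e₁`. -/
def botPoint : e₁.Pt := ⟨(2, 0), by decide, by decide⟩

/-- The left end point of the top arc of `e₁ ⊗ e₁`. -/
def topPoint₂ : (e₁.tensor e₁).Pt := ⟨(0, 0), by decide, by decide⟩

/-- A point on the circle of `e₁ ⊗ e₁`. -/
def midPoint₂ : (e₁.tensor e₁).Pt := ⟨(2, 0), by decide, by decide⟩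

/-- The left end point of the bottom arc of `e₁ ⊗ e₁`. -/
def botPoint₂ : (e₁.tensor e₁).Pt := ⟨(4, 0), by decide, by decide⟩

theorem e₁_point_cases (p : e₁.Pt) :
    p.1 = (0, 0) ∨ p.1 = (0, 1) ∨ p.1 = (2, 0) ∨ p.1 = (2, 1) := by
  obtain ⟨⟨l, j⟩, h, h'⟩ := p
  have : l ≤ 2 := h
  interval_cases l
  · have : j < 2 := h'
    interval_cases j <;> simp
  · exact (Nat.not_lt_zero j h').elim
  · have : j < 2 := h'
    interval_cases j <;> simp

theorem e₁_joined {p q : e₁.Pt} (h : e₁.Joined p q) : p.1.1 = q.1.1 := by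
  obtain ⟨l, L, hL, h⟩ := h
  have hl : l < 2 := (List.getElem?_eq_some_iff.1 hL).1
  have hp := e₁_point_cases p
  have hq := e₁_point_cases q
  generalize p.1 = z at *
  generalize q.1 = z' at *
  have := h.le
  rcases hp with rfl | rfl | rfl | rfl <;> rcases hq with rfl | rfl | rfl | rfl <;>
    simp at this ⊢ <;> omega

theorem e₁_line (p : e₁.Pt) : p.1.1 = 0 ∨ p.1.1 = 2 := by
  rcases e₁_point_cases p with h | h | h | h <;> simp [h]

/-- The diagram `e₁` consists of two arcs with end points on the lines `0` and `2`; no strand meets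
line `1`. -/
theorem e₁_component (p : e₁.Pt) :
    (p.1.1 = 0 → (Movie.nil : Movie e₁ e₁).component p =
      (Movie.nil : Movie e₁ e₁).component topPoint) ∧
    (p.1.1 ≠ 0 → (Movie.nil : Movie e₁ e₁).component p =
      (Movie.nil : Movie e₁ e₁).component botPoint) := by
  have h₁ : (Movie.nil : Movie e₁ e₁).component topPoint =
      (Movie.nil : Movie e₁ e₁).component ⟨(0, 1), by decide, by decide⟩ :=
    Movie.component_eq (m := (Movie.nil : Movie e₁ e₁)) ⟨0, .cup 0, rfl, .cup_turn 0⟩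
  have h₂ : (Movie.nil : Movie e₁ e₁).component botPoint =
      (Movie.nil : Movie e₁ e₁).component ⟨(2, 1), by decide, by decide⟩ :=
    Movie.component_eq (m := (Movie.nil : Movie e₁ e₁)) ⟨1, .cap 0, rfl, .cap_turn 0⟩
  obtain ⟨z, hz⟩ := p
  rcases e₁_point_cases ⟨z, hz⟩ with h | h | h | h <;> simp only at h <;> subst h
  · exact ⟨fun _ => rfl, fun h => (h rfl).elim⟩
  · exact ⟨fun _ => h₁.symm, fun h => (h rfl).elim⟩
  · exact ⟨fun h => (two_ne_zero h).elim, fun _ => rfl⟩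
  · exact ⟨fun h => (two_ne_zero h).elim, fun _ => h₂.symm⟩

theorem e₁_tensor_joined {P Q : (e₁.tensor e₁).Pt} (h : (e₁.tensor e₁).Joined P Q) :
    P.1.1 = Q.1.1 := by
  rcases Diagram.joined_tensor h with ⟨p, q, rfl, rfl, h'⟩ | ⟨p, q, rfl, rfl, h'⟩
  · exact e₁_joined h'
  · exact congrArg (e₁.word.length + ·) (e₁_joined h')

theorem e₁_tensor_point_cases (P : (e₁.tensor e₁).Pt) :
    P = topPoint₂ ∨ P = midPoint₂ ∨ P = botPoint₂ ∨ (e₁.tensor e₁).Joined topPoint₂ P ∨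
      (e₁.tensor e₁).Joined midPoint₂ P ∨ (e₁.tensor e₁).Joined botPoint₂ P := by
  obtain ⟨⟨l, j⟩, h, h'⟩ := P
  have : l ≤ 4 := h
  interval_cases l
  · have : j < 2 := h'
    interval_cases j
    · exact .inl rfl
    · exact .inr (.inr (.inr (.inl ⟨0, .cup 0, rfl, .cup_turn 0⟩)))
  · exact (Nat.not_lt_zero j h').elim
  · have : j < 2 := h'
    interval_cases j
    · exact .inr (.inl rfl)
    · exact .inr (.inr (.inr (.inr (.inl ⟨1, .cap 0, rfl, .cap_turn 0⟩))))
  · exact (Nat.not_lt_zero j h').elim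
  · have : j < 2 := h'
    interval_cases j
    · exact .inr (.inr (.inl rfl))
    · exact .inr (.inr (.inr (.inr (.inr ⟨3, .cap 0, rfl, .cap_turn 0⟩))))

theorem deathStep_meets (A : (e₁.tensor e₁).Pt → Prop) (B : e₁.Pt → Prop) :
    deathStep.Meets A B ↔ A midPoint₂ :=
  deathStep.meets_inl rfl _ rfl A B

theorem deathStep_matches_top : deathStep.Matches topPoint₂ topPoint :=
  ⟨rfl, .inl ⟨rfl, by decide⟩⟩

theorem deathStep_matches_bot : deathStep.Matches botPoint₂ botPoint :=
  ⟨rfl, .inr ⟨1, rfl, rfl⟩⟩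

open Classical in
/-- Splitting off a circle that dies is trivial. The circle belongs to the top arc if `2 ≤ k`, and
to the bottom arc otherwise. -/
theorem equivalent_saddle_death (s : Step e₁ (e₁.tensor e₁)) (k : ℕ) (pt : e₁.Pt)
    (hs : ∀ p q, s.Matches p q → (p.1.1 = 0 ↔ q.1.1 ≤ k))
    (hd : ∀ p q, deathStep.Matches p q → (p.1.1 ≤ k ↔ q.1.1 = 0))
    (hpt : pt = if 2 ≤ k then topPoint else botPoint) (hk : k < 4)
    (htop : s.Matches topPoint topPoint₂) (hmid : s.Matches pt midPoint₂)
    (hbot : s.Matches botPoint botPoint₂)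
    (hmeets : ∀ A B, s.Meets A B ↔ A pt) (hchi : s.event.chi = -1) (hdots : s.event.dots = 0) :
    (((Movie.nil : Movie e₁ e₁).snoc s).snoc deathStep).Equivalent Movie.nil := by
  let m : Movie e₁ e₁ := ((Movie.nil : Movie e₁ e₁).snoc s).snoc deathStep
  let m' : Movie e₁ e₁ := Movie.nil
  -- The middle slice is collapsed onto the arcs: everything up to line `k`, including the circle
  -- when `2 ≤ k`, goes to the top arc, the rest to the bottom arc.
  let F : m.Pt → m'.Pt := fun x => match x with
    | .inl (.inl x) => x
    | .inl (.inr x) => if x.1.1 ≤ k then topPoint else botPoint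
    | .inr y => y
  let G : m'.Pt → m.Pt := fun x => .inl (.inl x)
  let f : m'.Component → m.Component := Quot.map (fun x => .inl (.inl x)) fun _ _ h => h
  let f' : m'.Component → m.Component := Quot.map (fun x => .inr x) fun _ _ h => h
  have h₁ : ∀ x y, s.Matches x y → m.component (.inl (.inl x)) = m.component (.inl (.inr y)) :=
    fun x y h => Movie.component_eq (m := m) ⟨x, rfl, h⟩
  have h₂ : ∀ x y, deathStep.Matches x y → m.component (.inl (.inr x)) = m.component (.inr y) :=
    fun x y h => Movie.component_eq (m := m) ⟨x, rfl, h⟩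
  have hmidF : F (.inl (.inr midPoint₂)) = pt := hpt.symm
  refine Movie.Equivalent.of_maps (m := m) (m' := m') F G ?_ ?_ ?_ ?_ ?_ ?_ ?_ ?_
  · let u : m.Pt → Prop := fun x => match x with
      | .inl (.inl x) => x.1.1 = 0
      | .inl (.inr x) => x.1.1 ≤ k
      | .inr y => y.1.1 = 0
    have hu : ∀ x, (u x → m'.component (F x) = m'.component topPoint) ∧
        (¬ u x → m'.component (F x) = m'.component botPoint) := by
      rintro ((x | x) | x)
      · exact e₁_component x
      · exact ⟨fun h => congrArg m'.component (if_pos h), fun h => congrArg m'.component (if_neg h)⟩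
      · exact e₁_component x
    have : ∀ x y, m.Joined x y → (u x ↔ u y) := by
      rintro ((x | x) | x) ((y | y) | y) hxy
      · exact iff_of_eq (congrArg (· = 0) (e₁_joined hxy))
      · obtain ⟨r, rfl, hr⟩ := hxy
        exact hs _ _ hr
      · obtain ⟨r, hr, -⟩ := hxy
        cases hr
      · exact hxy.elim
      · exact iff_of_eq (congrArg (· ≤ k) (e₁_tensor_joined hxy))
      · obtain ⟨r, hr, hr'⟩ := hxy
        cases hr
        exact hd _ _ hr'
      · exact hxy.elim
      · exact hxy.elim
      · exact iff_of_eq (congrArg (· = 0) (e₁_joined hxy))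
    intro x y hxy
    by_cases hx : u x
    · rw [(hu x).1 hx, (hu y).1 ((this x y hxy).1 hx)]
    · rw [(hu x).2 hx, (hu y).2 (mt (this x y hxy).2 hx)]
  · exact fun x y h => Movie.component_eq (m := m) h
  · rintro ((x | x) | x)
    · rfl
    · have hJ : ∀ x y : (e₁.tensor e₁).Pt, (e₁.tensor e₁).Joined x y →
          m.component (G (F (.inl (.inr x)))) = m.component (.inl (.inr x)) →
          m.component (G (F (.inl (.inr y)))) = m.component (.inl (.inr y)) := by
        intro x y hxy h
        have e : F (.inl (.inr x)) = F (.inl (.inr y)) := by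
          simp only [F, e₁_tensor_joined hxy]
        rw [← e, h]
        exact Movie.component_eq (m := m) (p := .inl (.inr x)) (q := .inl (.inr y)) hxy
      have ht : m.component (G (F (.inl (.inr topPoint₂)))) = m.component (.inl (.inr topPoint₂)) :=
        h₁ _ _ htop
      have hm : m.component (G (F (.inl (.inr midPoint₂)))) =
          m.component (.inl (.inr midPoint₂)) := by
        rw [hmidF]; exact h₁ _ _ hmid
      have hb : m.component (G (F (.inl (.inr botPoint₂)))) =
          m.component (.inl (.inr botPoint₂)) := by
        have : F (.inl (.inr botPoint₂)) = botPoint := if_neg (not_le.2 hk)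
        rw [this]; exact h₁ _ _ hbot
      rcases e₁_tensor_point_cases x with rfl | rfl | rfl | h | h | h
      · exact ht
      · exact hm
      · exact hb
      · exact hJ _ _ h ht
      · exact hJ _ _ h hm
      · exact hJ _ _ h hb
    · change f (m'.component x) = f' (m'.component x)
      by_cases hx : x.1.1 = 0
      · rw [(e₁_component x).1 hx]
        exact (h₁ _ _ htop).trans (h₂ _ _ deathStep_matches_top)
      · rw [(e₁_component x).2 hx]
        exact (h₁ _ _ hbot).trans (h₂ _ _ deathStep_matches_bot)
  · exact fun _ => rfl
  · exact fun _ => rfl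
  · exact fun _ => rfl
  · intro c
    refine (Movie.chi_two _ _ _).trans ?_
    have e : deathStep.event.chi = 1 := rfl
    -- Saddle and death lie on the same component, where `-1 + 1 = 0`.
    simp only [hmeets, deathStep_meets, hmidF, hchi, e]
    split_ifs <;> rfl
  · intro c
    refine (Movie.dots_two _ _ _).trans ?_
    have e : deathStep.event.dots = 0 := rfl
    rw [hdots, e, ite_self, ite_self]
    rfl

/-- The lines `1` and `3` of `e₁ ⊗ e₁` carry no points, and line `2` holds only the dying circle; so
only the outer lines continue. -/
theorem deathStep_matches_iff {p : (e₁.tensor e₁).Pt} {q : e₁.Pt} (h : deathStep.Matches p q) :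
    (p.1.1 = 0 ∧ q.1.1 = 0) ∨ (p.1.1 = 4 ∧ q.1.1 = 2) := by
  have hq := e₁_line q
  have h0 : p.1.1 ≠ 1 := fun h => Nat.not_lt_zero p.1.2 (by
    have := p.2.2; rw [h] at this; exact this)
  have h3 : p.1.1 ≠ 3 := fun h => Nat.not_lt_zero p.1.2 (by
    have := p.2.2; rw [h] at this; exact this)
  obtain ⟨-, ⟨h₁, h₂⟩ | ⟨r, h₁, h₂⟩⟩ := h
  · simp only [deathStep, List.length_cons, List.length_nil] at h₂
    omega
  · simp only [deathStep, List.length_cons, List.length_nil] at h₁ h₂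
    omega

theorem equivalent_saddleTop_death :
    (((Movie.nil : Movie e₁ e₁).snoc saddleTop).snoc deathStep).Equivalent Movie.nil := by
  refine equivalent_saddle_death saddleTop 2 topPoint ?_ ?_ rfl (by decide) ?_ ?_ ?_ ?_ rfl rfl
  · rintro p q ⟨-, ⟨h₁, h₂⟩ | ⟨r, h₁, h₂⟩⟩
    · simp only [saddleTop, List.length_nil] at h₂
      omega
    · simp only [saddleTop, List.length_cons, List.length_nil] at h₁ h₂
      omega
  · intro p q h
    rcases deathStep_matches_iff h with h | h <;> omega
  · exact ⟨rfl, .inl ⟨rfl, by decide⟩⟩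
  · exact ⟨rfl, .inr ⟨0, rfl, rfl⟩⟩
  · exact ⟨rfl, .inr ⟨2, rfl, rfl⟩⟩
  · exact saddleTop.meets_inl rfl _ rfl

theorem equivalent_saddleBot_death :
    (((Movie.nil : Movie e₁ e₁).snoc saddleBot).snoc deathStep).Equivalent Movie.nil := by
  refine equivalent_saddle_death saddleBot 1 botPoint ?_ ?_ rfl (by decide) ?_ ?_ ?_ ?_ rfl rfl
  · rintro p q ⟨-, ⟨h₁, h₂⟩ | ⟨r, h₁, h₂⟩⟩
    · have := e₁_line p
      omega
    · simp only [saddleBot, e₁, e, List.length_cons, List.length_nil] at h₁ h₂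
      omega
  · intro p q h
    rcases deathStep_matches_iff h with h | h <;> omega
  · exact ⟨rfl, .inl ⟨rfl, by decide⟩⟩
  · exact ⟨rfl, .inl ⟨rfl, by decide⟩⟩
  · exact ⟨rfl, .inr ⟨0, rfl, rfl⟩⟩
  · exact saddleBot.meets_inl rfl _ rfl

/-! ### Relations in `Cob 2` -/

namespace Cob

/-- The morphism given by a movie. -/
def cls {a b : Diagram n} (p q : ℤ) (m : Movie a b) : Cob.obj a p ⟶ Cob.obj b q :=
  (Quotient.functor (rel n)).map (lin p q m)

variable {a b c d : Diagram n}

theorem ofMovie_one (p q : ℤ) (m : Movie a b) :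
    Cob.ofMovie (X := Cob.obj a p) (Y := Cob.obj b q) 1 m = cls p q m :=
  congrArg (Quotient.functor (rel n)).map (one_smul R (lin p q m))

theorem cls_comp (p q r : ℤ) (m : Movie a b) (m' : Movie b c) :
    cls p q m ≫ cls q r m' = cls p r (m.comp m') :=
  ((Quotient.functor (rel n)).map_comp (lin p q m) (lin q r m')).symm.trans
    (congrArg (Quotient.functor (rel n)).map
      ((Free.embedding R (GradedDiagram n)).map_comp
        (X := ⟨a, p⟩) (Y := ⟨b, q⟩) (Z := ⟨c, r⟩) m m').symm)

theorem cls_nil (p : ℤ) : cls p p (Movie.nil : Movie a a) = 𝟙 (Cob.obj a p) :=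
  (congrArg (Quotient.functor (rel n)).map
    ((Free.embedding R (GradedDiagram n)).map_id (⟨a, p⟩ : GradedDiagram n))).trans
    ((Quotient.functor (rel n)).map_id _)

theorem cls_eq_of_rel {p q : ℤ} {m : Movie a b}
    {f : Free.of R (⟨a, p⟩ : GradedDiagram n) ⟶ Free.of R (⟨b, q⟩ : GradedDiagram n)}
    (h : Rel n (lin p q m) f) : cls p q m = (Quotient.functor (rel n)).map f :=
  CategoryTheory.Quotient.sound (rel n) h

theorem cls_eq_of_equivalent {m m' : Movie a b} (h : m.Equivalent m') (p q : ℤ) :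
    cls p q m = cls p q m' := cls_eq_of_rel (Rel.equivalent p q m m' h)

/-- Movies carry no `q`-degree. Quantifying over the degrees permits rewriting inside a composite
with an arbitrary choice for the middle object. -/
theorem cls_comp_congr {m₁ m₁' : Movie a b} {m₂ m₂' : Movie b c}
    (h₁ : ∀ p q, cls p q m₁ = cls p q m₁') (h₂ : ∀ p q, cls p q m₂ = cls p q m₂') (p q : ℤ) :
    cls p q (m₁.comp m₂) = cls p q (m₁'.comp m₂') := by
  rw [← cls_comp p p q, ← cls_comp p p q, h₁, h₂]

theorem cls_comp_left (m : Movie a b) {m₂ m₂' : Movie b c}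
    (h₂ : ∀ p q, cls p q m₂ = cls p q m₂') (p q : ℤ) :
    cls p q (m.comp m₂) = cls p q (m.comp m₂') := cls_comp_congr (fun _ _ => rfl) h₂ p q

theorem cls_comp_right (m : Movie b c) {m₁ m₁' : Movie a b}
    (h₁ : ∀ p q, cls p q m₁ = cls p q m₁') (p q : ℤ) :
    cls p q (m₁.comp m) = cls p q (m₁'.comp m) := cls_comp_congr h₁ (fun _ _ => rfl) p q

theorem preTop_lin (D : GradedDiagram n) (p q : ℤ) (m : Movie a b) :
    (preTop D).map (lin p q m) = lin (D.deg + p) (D.deg + q) (m.glueTop D.diagram) :=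
  (Free.lift_map_single R (gradedTop D ⋙ Free.embedding R (GradedDiagram n))
    (X := (⟨a, p⟩ : GradedDiagram n)) (Y := ⟨b, q⟩) (f := m) (r := 1)).trans (one_smul R _)

theorem preBot_lin (D : GradedDiagram n) (p q : ℤ) (m : Movie a b) :
    (preBot D).map (lin p q m) = lin (p + D.deg) (q + D.deg) (m.glueBot D.diagram) :=
  (Free.lift_map_single R (gradedBot D ⋙ Free.embedding R (GradedDiagram n))
    (X := (⟨a, p⟩ : GradedDiagram n)) (Y := ⟨b, q⟩) (f := m) (r := 1)).trans (one_smul R _)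

theorem tensorLeft_cls (D : GradedDiagram n) (p q : ℤ) (m : Movie a b) :
    (Cob.tensorLeft D).map (cls p q m) = cls (D.deg + p) (D.deg + q) (m.glueTop D.diagram) :=
  congrArg (Quotient.functor (rel n)).map (preTop_lin D p q m)

theorem tensorRight_cls (D : GradedDiagram n) (p q : ℤ) (m : Movie a b) :
    (Cob.tensorRight D).map (cls p q m) = cls (p + D.deg) (q + D.deg) (m.glueBot D.diagram) :=
  congrArg (Quotient.functor (rel n)).map (preBot_lin D p q m)

end Cob

open Cob

/-! ### Neck cutting for a circle next to an arc -/

/-- The circle of `e₁ ⊗ e₁` dies. -/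
def circleDeath : Movie (e₁.tensor e₁) e₁ := .ofStep deathStep

/-- A circle is born in the middle of `e₁`. -/
def circleBirth : Movie e₁ (e₁.tensor e₁) := .ofStep birthStep

/-- A dot on the circle of `e₁ ⊗ e₁`. -/
def circleDot : Movie (e₁.tensor e₁) (e₁.tensor e₁) := .ofStep (dotStep _ midPoint₂)

/-- The circle of `e₁ ⊗ e₁` is replaced by another one. -/
def circleSwap : Movie (e₁.tensor e₁) (e₁.tensor e₁) := circleDeath.comp circleBirth

theorem cls_neck (p q : ℤ) : cls p q (Movie.nil : Movie (e₁.tensor e₁) (e₁.tensor e₁)) =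
    cls p q (circleSwap.comp circleDot) + cls p q (circleDot.comp circleSwap) :=
  cls_eq_of_rel (Rel.neck midSite p q)

theorem cls_sphere_dot_dot (p q : ℤ) :
    cls p q (circleBirth.comp (circleDot.comp (circleDot.comp circleDeath))) = 0 :=
  cls_eq_of_rel (Rel.sphere_dot_dot midSite p q)

/-- An arc of `e₁` next to the circle. -/
structure Arc where
  saddle : Step e₁ (e₁.tensor e₁)
  pt : e₁.Pt
  pt₂ : (e₁.tensor e₁).Pt
  saddle_death : (((Movie.nil : Movie e₁ e₁).snoc saddle).snoc deathStep).Equivalent .nil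
  saddle_matches : saddle.Matches pt pt₂
  saddle_matches_mid : saddle.Matches pt midPoint₂
  death_matches : deathStep.Matches pt₂ pt
  birth_matches : birthStep.Matches pt pt₂

/-- The top arc of `e₁`. -/
def topArc : Arc where
  saddle := saddleTop
  pt := topPoint
  pt₂ := topPoint₂
  saddle_death := equivalent_saddleTop_death
  saddle_matches := ⟨rfl, .inl ⟨rfl, by decide⟩⟩
  saddle_matches_mid := ⟨rfl, .inr ⟨0, rfl, rfl⟩⟩
  death_matches := deathStep_matches_top
  birth_matches := ⟨rfl, .inl ⟨rfl, by decide⟩⟩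

/-- The bottom arc of `e₁`. -/
def botArc : Arc where
  saddle := saddleBot
  pt := botPoint
  pt₂ := botPoint₂
  saddle_death := equivalent_saddleBot_death
  saddle_matches := ⟨rfl, .inr ⟨0, rfl, rfl⟩⟩
  saddle_matches_mid := ⟨rfl, .inl ⟨rfl, by decide⟩⟩
  death_matches := deathStep_matches_bot
  birth_matches := ⟨rfl, .inr ⟨1, rfl, rfl⟩⟩

namespace Arc

variable (A : Arc)

/-- The circle is split off the arc. -/
def split : Movie e₁ (e₁.tensor e₁) := .ofStep A.saddle

/-- A dot on the arc. -/
def dot : Movie e₁ e₁ := .ofStep (dotStep _ A.pt)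

/-- A dot on the arc, in the presence of the circle. -/
def dot₂ : Movie (e₁.tensor e₁) (e₁.tensor e₁) := .ofStep (dotStep _ A.pt₂)

theorem cls_split_death (p q : ℤ) : cls p q (A.split.comp circleDeath) = cls p q .nil :=
  cls_eq_of_equivalent A.saddle_death p q

/-- After the saddle, circle and arc bound one component: the dot slides from the circle to the arc
and then back through the saddle. -/
theorem cls_split_circleDot (p q : ℤ) :
    cls p q (A.split.comp circleDot) = cls p q (A.dot.comp A.split) := by
  let m : Movie e₁ (e₁.tensor e₁) := A.split
  have h₁ : m.component (m.first A.pt) = m.component (m.last A.pt₂) :=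
    Movie.component_eq (m := m) ⟨A.pt, rfl, A.saddle_matches⟩
  have h₂ : m.component (m.first A.pt) = m.component (m.last midPoint₂) :=
    Movie.component_eq (m := m) ⟨A.pt, rfl, A.saddle_matches_mid⟩
  exact (cls_eq_of_equivalent (equivalent_dot_move m (h₂.symm.trans h₁)) p q).trans
    (cls_eq_of_equivalent (equivalent_dot_comm A.saddle A.saddle_matches) p q).symm

theorem cls_dot₂_death (p q : ℤ) :
    cls p q (A.dot₂.comp circleDeath) = cls p q (circleDeath.comp A.dot) :=
  cls_eq_of_equivalent (equivalent_dot_comm deathStep A.death_matches) p q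

theorem cls_dot_birth (p q : ℤ) :
    cls p q (A.dot.comp circleBirth) = cls p q (circleBirth.comp A.dot₂) :=
  cls_eq_of_equivalent (equivalent_dot_comm birthStep A.birth_matches) p q

/-- The circle dies and is reborn away from the arc that carries the dot. This is the relation `xs =
sx` of the contracting homotopy. -/
theorem cls_dot₂_swap (p q : ℤ) :
    cls p q (A.dot₂.comp circleSwap) = cls p q (circleSwap.comp A.dot₂) := by
  rw [circleSwap, ← Movie.comp_assoc, Movie.comp_assoc circleDeath,
    cls_comp_right circleBirth A.cls_dot₂_death, Movie.comp_assoc,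
    cls_comp_left circleDeath A.cls_dot_birth]

/-- Neck cutting of the tube between the arc and the circle. -/
theorem cls_split (p q : ℤ) : cls p q A.split =
    cls p q (circleBirth.comp circleDot) + cls p q (A.dot.comp circleBirth) := by
  -- In each term of the neck relation applied after the saddle, the split circle dies again and
  -- only a new circle remains. The dot is on this circle in the first term, on the arc in the
  -- second.
  have h₁ : cls p q (A.split.comp (circleSwap.comp circleDot)) =
      cls p q (circleBirth.comp circleDot) := by
    rw [circleSwap, Movie.comp_assoc, ← Movie.comp_assoc A.split,
      cls_comp_right _ A.cls_split_death, Movie.nil_comp]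
  have h₂ : cls p q (A.split.comp (circleDot.comp circleSwap)) =
      cls p q (A.dot.comp circleBirth) := by
    rw [← Movie.comp_assoc, cls_comp_right _ A.cls_split_circleDot, circleSwap, Movie.comp_assoc,
      ← Movie.comp_assoc A.split, cls_comp_left A.dot (cls_comp_right circleBirth
        A.cls_split_death), Movie.nil_comp]
  rw [← h₁, ← h₂, ← cls_comp p p q A.split, ← cls_comp p p q A.split, ← Preadditive.comp_add,
    ← cls_neck, cls_comp]
  rfl

/-- Neck cutting of the saddle after the death of a circle. It supplies the term `sc + xs` where the
homotopy meets the first differential. -/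
theorem cls_death_split (p q : ℤ) : cls p q (circleDeath.comp A.split) =
    cls p q (circleSwap.comp circleDot) + cls p q (A.dot₂.comp circleSwap) := by
  rw [← cls_comp p p q, A.cls_split, Preadditive.comp_add, cls_comp, cls_comp, circleSwap,
    Movie.comp_assoc, ← Movie.comp_assoc A.dot₂, cls_comp_right circleBirth A.cls_dot₂_death,
    Movie.comp_assoc]

/-- Two dots on an arc can be moved to a sphere. -/
theorem cls_dot_dot (p q : ℤ) : cls p q (A.dot.comp A.dot) =
    cls p q (circleBirth.comp (circleDot.comp (circleDot.comp (circleDot.comp circleDeath)))) := by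
  -- Both dots travel through the tube onto a circle that is split off and then dies.
  have h : cls p q (A.dot.comp A.dot) =
      cls p q (A.split.comp (circleDot.comp (circleDot.comp circleDeath))) := by
    symm
    rw [← Movie.comp_assoc, cls_comp_right _ A.cls_split_circleDot, Movie.comp_assoc]
    refine cls_comp_left A.dot (fun p q => ?_) p q
    rw [← Movie.comp_assoc, cls_comp_right _ A.cls_split_circleDot, Movie.comp_assoc,
      cls_comp_left A.dot A.cls_split_death]
    rfl
  -- Cutting the tube puts a third dot on the sphere or leaves it on the arc; the latter term
  -- contains a sphere with two dots and vanishes.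
  rw [h, ← cls_comp p p q, A.cls_split, Preadditive.add_comp, cls_comp, cls_comp,
    Movie.comp_assoc, Movie.comp_assoc, ← cls_comp p p q A.dot, cls_sphere_dot_dot, comp_zero,
    add_zero]

end Arc

theorem cls_dotTop_dotBot (p q : ℤ) :
    cls p q (dotTop.comp dotBot) = cls p q (dotBot.comp dotTop) :=
  cls_eq_of_equivalent (equivalent_dot_comm (dotStep e₁ botPoint) (p := topPoint) (q := topPoint)
    ((dotStep_matches _ _ _).2 rfl)) p q

/-- Both sides equal the sphere with three dots in the middle of `e₁`, which does not see which arc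
the dots came from. -/
theorem cls_dotTop_dotTop (p q : ℤ) :
    cls p q (dotTop.comp dotTop) = cls p q (dotBot.comp dotBot) :=
  (topArc.cls_dot_dot p q).trans (botArc.cls_dot_dot p q).symm

/-- The surface of the saddle is connected, so the dot slides from one arc to the other. -/
theorem cls_saddle_dot (p q : ℤ) :
    cls p q (saddle.comp dotTop) = cls p q (saddle.comp dotBot) := by
  let x : (one 2).Pt := ⟨(0, 0), by decide, by decide⟩
  have h₁ : saddle.component (saddle.first x) = saddle.component (saddle.last topPoint) :=
    Movie.component_eq (m := saddle) ⟨x, rfl, rfl, .inl ⟨rfl, by decide⟩⟩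
  have h₂ : saddle.component (saddle.first x) = saddle.component (saddle.last botPoint) :=
    Movie.component_eq (m := saddle) ⟨x, rfl, rfl, .inr ⟨0, rfl, rfl⟩⟩
  exact cls_eq_of_equivalent (equivalent_dot_move saddle (h₁.symm.trans h₂)) p q

open Cob

/-! ### The chain complex -/

/-- A morphism of `Cob n` as a `1 × 1` matrix. -/
abbrev emb {X Y : Cob n} (f : X ⟶ Y) :
    (Mat_.embedding (Cob n)).obj X ⟶ (Mat_.embedding (Cob n)).obj Y :=
  (Mat_.embedding (Cob n)).map f

theorem emb_comp {X Y Z : Cob n} (f : X ⟶ Y) (g : Y ⟶ Z) : emb f ≫ emb g = emb (f ≫ g) :=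
  ((Mat_.embedding (Cob n)).map_comp f g).symm

theorem mat_eq_emb {a b : Diagram n} (p q : ℤ) (m : Movie a b) : mat p q m = emb (cls p q m) :=
  congrArg (Mat_.embedding (Cob n)).map (ofMovie_one p q m)

theorem cls_mem_degreeZero {a b : Diagram n} {p q : ℤ} {m : Movie a b}
    (h : m.degree + (q - p) = 0) : cls p q m ∈ degreeZero (obj a p) (obj b q) := by
  refine AddSubgroup.subset_closure ⟨0, m, ?_, ?_⟩
  · change m.degree + (q - p) - 4 * ((0 : ℕ) : ℤ) = 0
    simpa using h
  · rw [pow_zero]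
    exact (ofMovie_one p q m).symm

theorem emb_homotopy {X Y Z : Cob n} {f : X ⟶ Y} {g : Y ⟶ X} {f' : X ⟶ Z} {g' : Z ⟶ X}
    (h : f ≫ g + f' ≫ g' = 𝟙 X) : emb f ≫ emb g + emb f' ≫ emb g' = 𝟙 _ := by
  rw [emb_comp, emb_comp]
  exact ((Mat_.embedding (Cob n)).map_add).symm.trans
    ((congrArg emb h).trans ((Mat_.embedding (Cob n)).map_id X))

/-- The `q`-degree of the chain group in homological degree `k + 1`. -/
abbrev qdeg (k : ℕ) : ℤ := 2 * ((k : ℤ) + 1) - 1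

/-- The differential in homological degree `k + 1`. -/
def dotDiff (k : ℕ) : obj e₁ (qdeg k) ⟶ obj e₁ (qdeg (k + 1)) :=
  if Odd (k + 1) then cls _ _ dotTop - cls _ _ dotBot else cls _ _ dotTop + cls _ _ dotBot

/-- The differential in homological degree `0`. -/
def saddleDiff : obj (one 2) 0 ⟶ obj e₁ (qdeg 0) := cls _ _ saddle

theorem P₂d_zero : P₂d (.ofNat 0) = emb saddleDiff := mat_eq_emb _ _ _

theorem P₂d_succ (k : ℕ) : P₂d (.ofNat (k + 1)) = emb (dotDiff k) := by
  rw [dotDiff, P₂d]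
  split_ifs
  · exact (congrArg₂ (· - ·) (mat_eq_emb _ _ _) (mat_eq_emb _ _ _)).trans
      ((Mat_.embedding (Cob 2)).map_sub).symm
  · exact (congrArg₂ (· + ·) (mat_eq_emb _ _ _) (mat_eq_emb _ _ _)).trans
      ((Mat_.embedding (Cob 2)).map_add).symm

theorem saddleDiff_comp : saddleDiff ≫ dotDiff 0 = 0 := by
  rw [dotDiff, if_pos (by decide), saddleDiff, Preadditive.comp_sub, cls_comp, cls_comp,
    cls_saddle_dot, sub_self]

/-- Consecutive signs differ, so the product is `t² - b²`, up to commuting dots. -/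
theorem dotDiff_comp (k : ℕ) : dotDiff k ≫ dotDiff (k + 1) = 0 := by
  rw [dotDiff, dotDiff]
  by_cases h : Odd (k + 1)
  · rw [if_pos h, if_neg (by rw [Nat.odd_add_one]; simpa using h)]
    simp only [Preadditive.comp_add, Preadditive.sub_comp, cls_comp, cls_dotTop_dotTop,
      cls_dotTop_dotBot]
    abel
  · rw [if_neg h, if_pos (by rw [Nat.odd_add_one]; simpa using h)]
    simp only [Preadditive.comp_sub, Preadditive.add_comp, cls_comp, cls_dotTop_dotTop,
      cls_dotTop_dotBot]
    abel

theorem emb_zero {X Y : Cob n} : emb (0 : X ⟶ Y) = 0 := (Mat_.embedding (Cob n)).map_zero X Y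

theorem P₂d_comp (k : ℤ) : P₂d k ≫ P₂d (k + 1) = 0 := by
  match k with
  | .ofNat 0 =>
    refine (congrArg₂ (· ≫ ·) P₂d_zero (P₂d_succ 0)).trans ?_
    exact (emb_comp _ _).trans ((congrArg emb saddleDiff_comp).trans emb_zero)
  | .ofNat (k + 1) =>
    refine (congrArg₂ (· ≫ ·) (P₂d_succ k) (P₂d_succ (k + 1))).trans ?_
    exact (emb_comp _ _).trans ((congrArg emb (dotDiff_comp k)).trans emb_zero)
  | .negSucc k => exact zero_comp

theorem isZero_of_isEmpty (M : Mat_ (Cob n)) [IsEmpty M.ι] : IsZero M :=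
  (IsZero.iff_id_eq_zero M).2 (funext fun i => isEmptyElim i)

theorem isZero_P₂X {k : ℤ} (hk : k < 0) : IsZero (P₂X k) := by
  match k, hk with
  | .negSucc k, _ => exact @isZero_of_isEmpty 2 _ (inferInstanceAs (IsEmpty Empty))

theorem saddleDiff_mem : saddleDiff ∈ degreeZero (obj (one 2) 0) (obj e₁ (qdeg 0)) :=
  cls_mem_degreeZero rfl

theorem dotDiff_mem (k : ℕ) :
    dotDiff k ∈ degreeZero (obj e₁ (qdeg k)) (obj e₁ (qdeg (k + 1))) := by
  have h : ∀ j : Movie e₁ e₁, j.degree = -2 →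
      cls (qdeg k) (qdeg (k + 1)) j ∈ degreeZero (obj e₁ (qdeg k)) (obj e₁ (qdeg (k + 1))) :=
    fun j hj => cls_mem_degreeZero (by rw [hj, qdeg, qdeg]; push_cast; ring)
  rw [dotDiff]
  split_ifs
  · exact sub_mem (h _ rfl) (h _ rfl)
  · exact add_mem (h _ rfl) (h _ rfl)

theorem isDegreeZero_emb {X Y : Cob n} {f : X ⟶ Y} (h : f ∈ degreeZero X Y) :
    IsDegreeZero (emb f) := fun _ _ => h

theorem isDegreeZero_P₂d (k : ℤ) : IsDegreeZero (P₂d k) := by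
  match k with
  | .ofNat 0 => rw [P₂d_zero]; exact isDegreeZero_emb saddleDiff_mem
  | .ofNat (k + 1) => rw [P₂d_succ]; exact isDegreeZero_emb (dotDiff_mem k)
  | .negSucc k => exact fun i => i.elim

theorem contractible_of_homotopy (C : Cpx n) (h : ∀ k, C.X (k + 1) ⟶ C.X k)
    (hdeg : ∀ k, IsDegreeZero (h k))
    (hcomm : ∀ k, C.d (k + 1) (k + 1 + 1) ≫ h (k + 1) + h k ≫ C.d k (k + 1) = 𝟙 _) :
    Contractible C := by
  let h' : ∀ i j, (ComplexShape.up ℤ).Rel j i → (C.X i ⟶ C.X j) := fun i j r =>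
    eqToHom (congrArg C.X (show j + 1 = i from r).symm) ≫ h j
  have h'_eq : ∀ j r, h' (j + 1) j r = h j := fun j r => Category.id_comp _
  have key : 𝟙 C = Homotopy.nullHomotopicMap' h' := by
    ext1 k
    -- Centring at `k + 1` puts the incoming index in the form in which `h` and `hcomm` are stated.
    obtain ⟨k, rfl⟩ : ∃ j, k = j + 1 := ⟨k - 1, by ring⟩
    have h₁ : (ComplexShape.up ℤ).Rel k (k + 1) := rfl
    have h₂ : (ComplexShape.up ℤ).Rel (k + 1) (k + 1 + 1) := rfl
    rw [Homotopy.nullHomotopicMap'_f h₁ h₂, h'_eq k h₁, h'_eq (k + 1) h₂, hcomm]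
    rfl
  rw [Contractible, key]
  refine ⟨Homotopy.nullHomotopy' h', fun i j => ?_⟩
  by_cases r : (ComplexShape.up ℤ).Rel j i
  · have r' : j + 1 = i := r
    subst r'
    have h_eq : (Homotopy.nullHomotopy' h').hom (j + 1) j = h j := (dif_pos r).trans (h'_eq j r)
    rw [h_eq]
    exact hdeg j
  · rw [(Homotopy.nullHomotopy' h').zero i j r]
    exact fun _ _ => zero_mem _

/-- Every chain object has at most one summand, so a contraction amounts to identities in `Cob 2`
itself. `F` will be gluing of `e₁` on either side. -/
theorem contractible_map (F : Cob 2 ⥤ Cob 2) [F.Additive]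
    (h₀ : F.obj (obj e₁ (qdeg 0)) ⟶ F.obj (obj (one 2) 0))
    (h : ∀ k, F.obj (obj e₁ (qdeg (k + 1))) ⟶ F.obj (obj e₁ (qdeg k)))
    (hdeg₀ : h₀ ∈ degreeZero _ _) (hdeg : ∀ k, h k ∈ degreeZero _ _)
    (hcomm₀ : F.map saddleDiff ≫ h₀ = 𝟙 _)
    (hcomm₁ : F.map (dotDiff 0) ≫ h 0 + h₀ ≫ F.map saddleDiff = 𝟙 _)
    (hcomm : ∀ k, F.map (dotDiff (k + 1)) ≫ h (k + 1) + h k ≫ F.map (dotDiff k) = 𝟙 _) :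
    Contractible ((F.mapMat_.mapHomologicalComplex _).obj
      (CochainComplex.of P₂X P₂d P₂d_comp)) := by
  let E : ℤ → Mat_ (Cob 2) := fun q => (Mat_.embedding (Cob 2)).obj (F.obj (obj e₁ q))
  let E' : Mat_ (Cob 2) := (Mat_.embedding (Cob 2)).obj (F.obj (obj (one 2) 0))
  let H : ∀ k : ℤ, F.mapMat_.obj (P₂X (k + 1)) ⟶ F.mapMat_.obj (P₂X k) := fun k =>
    match k with
    | .ofNat 0 => emb h₀
    | .ofNat (k + 1) => emb (h k)
    | .negSucc _ => 0
  have hd : ∀ k, ((F.mapMat_.mapHomologicalComplex _).obj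
      (CochainComplex.of P₂X P₂d P₂d_comp)).d k (k + 1) = F.mapMat_.map (P₂d k) := fun k =>
    congrArg F.mapMat_.map (CochainComplex.of_d _ _ _)
  have hd₀ : F.mapMat_.map (P₂d (.ofNat 0)) = emb (F.map saddleDiff) :=
    congrArg F.mapMat_.map P₂d_zero
  have hd₁ : ∀ k, F.mapMat_.map (P₂d (.ofNat (k + 1))) = emb (F.map (dotDiff k)) := fun k =>
    congrArg F.mapMat_.map (P₂d_succ k)
  refine contractible_of_homotopy _ H (fun k => ?_) (fun k => ?_)
  · match k with
    | .ofNat 0 => exact isDegreeZero_emb hdeg₀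
    | .ofNat (k + 1) => exact isDegreeZero_emb (hdeg k)
    | .negSucc k => exact fun _ j => j.elim
  · rw [hd, hd]
    match k with
    | .ofNat 0 =>
      refine Eq.trans ?_ (emb_homotopy hcomm₁)
      exact congrArg₂ (fun (x : E (qdeg 0) ⟶ E (qdeg 1)) (y : E' ⟶ E (qdeg 0)) =>
        x ≫ emb (h 0) + emb h₀ ≫ y) (hd₁ 0) hd₀
    | .ofNat (k + 1) =>
      refine Eq.trans ?_ (emb_homotopy (hcomm k))
      exact congrArg₂ (fun (x : E (qdeg (k + 1)) ⟶ E (qdeg (k + 2))) (y : E _ ⟶ E _) =>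
        x ≫ emb (h (k + 1)) + emb (h k) ≫ y) (hd₁ (k + 1)) (hd₁ k)
    -- Here `k = -1`: this is the identity in homological degree `0`, where the term from degree
    -- `-1` is zero.
    | .negSucc 0 =>
      refine Eq.trans ?_ ((emb_comp _ _).trans ((congrArg emb hcomm₀).trans
        ((Mat_.embedding (Cob 2)).map_id _)))
      exact (congrArg₂ (fun (x y : E' ⟶ E') => x + y)
        (congrArg (fun (x : E' ⟶ E (qdeg 0)) => x ≫ emb h₀) hd₀) zero_comp).trans (add_zero _)
    | .negSucc (k + 1) => exact funext fun i => i.elim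

/-! ### The homotopies -/

namespace Arc

variable (A : Arc)

/-- This is `(c + s x)S + S(c - s x) = cS + Sc = 1` with `S` the swap of circles: the terms with `x`
cancel because `x` commutes with `S`, and the rest is neck cutting. -/
theorem homotopy (p q r s : ℤ) :
    (cls p q circleDot + s • cls p q A.dot₂) ≫ cls q p circleSwap +
      cls p r circleSwap ≫ (cls r p circleDot - s • cls r p A.dot₂) = 𝟙 _ := by
  rw [← cls_nil, cls_neck]
  simp only [Preadditive.add_comp, Preadditive.comp_sub, Preadditive.zsmul_comp,
    Preadditive.comp_zsmul, cls_comp, A.cls_dot₂_swap]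
  abel

/-- The same cancellation at the first differential: death followed by the saddle is `Sc + xS`, and
the `xS` cancels against the term from `c - x`. -/
theorem homotopy_split (p q r : ℤ) :
    (cls p q circleDot - cls p q A.dot₂) ≫ cls q p circleSwap +
      cls p r circleDeath ≫ cls r p A.split = 𝟙 _ := by
  rw [← cls_nil, cls_neck]
  simp only [Preadditive.sub_comp, cls_comp, A.cls_death_split]
  abel

end Arc

/-- The sign of the second summand of the differential in homological degree `k + 1`. -/
def sign (k : ℕ) : ℤ := if Odd (k + 1) then -1 else 1

theorem sign_succ (k : ℕ) : sign (k + 1) = -sign k := by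
  by_cases h : Odd (k + 1) <;> simp [sign, Nat.odd_add_one (n := k + 1), h]

theorem sign_mul_self (k : ℕ) : sign k * sign k = 1 := by
  rw [sign]
  split_ifs <;> rfl

theorem dotDiff_eq (k : ℕ) : dotDiff k = cls _ _ dotTop + sign k • cls _ _ dotBot := by
  rw [dotDiff, sign]
  split_ifs
  · rw [neg_smul, one_smul, sub_eq_add_neg]
  · rw [one_smul]

theorem map_dotDiff (F : Cob 2 ⥤ Cob 2) [F.Additive] (k : ℕ) :
    F.map (dotDiff k) = F.map (cls _ _ dotTop) + sign k • F.map (cls _ _ dotBot) := by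
  rw [dotDiff_eq, F.map_add, F.map_zsmul]

theorem circleSwap_mem {p q : ℤ} (h : p = q + 2) :
    cls p q circleSwap ∈ degreeZero (obj (e₁.tensor e₁) p) (obj (e₁.tensor e₁) q) :=
  cls_mem_degreeZero (by rw [h]; change (2 : ℤ) + _ = 0; ring)

/-- For `s = ±1` the sign moves from one dot to the other. This is needed when the circle carries
the signed dot of the differential. -/
theorem add_zsmul_comp_zsmul {C : Type*} [Category* C] [Preadditive C] {X Y Z : C} {s : ℤ}
    (hs : s * s = 1) (f g : X ⟶ Y) (h : Y ⟶ Z) : (f + s • g) ≫ (s • h) = (g + s • f) ≫ h := by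
  simp only [Preadditive.comp_zsmul, Preadditive.add_comp, Preadditive.zsmul_comp, smul_add,
    smul_smul, hs, one_smul]
  abel

theorem zsmul_comp_add_zsmul {C : Type*} [Category* C] [Preadditive C] {X Y Z : C} {s : ℤ}
    (hs : s * s = 1) (f g : Y ⟶ Z) (h : X ⟶ Y) : (s • h) ≫ (f + s • g) = h ≫ (g + s • f) := by
  simp only [Preadditive.comp_zsmul, Preadditive.comp_add, Preadditive.zsmul_comp,
    smul_smul, hs, one_smul]
  abel

/-- With `e₁` on top, the top arc closes up to the circle, so `t` becomes `c` and `b` remains on the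
bottom arc. The signs of consecutive differentials alternate as `Arc.homotopy` requires. -/
theorem contractible_tensorLeft :
    Contractible (tensorLeft e₁ (CochainComplex.of P₂X P₂d P₂d_comp)) := by
  let E : ℤ → Cob 2 := fun q => obj (e₁.tensor e₁) q
  have hdot : ∀ k, (Cob.tensorLeft ⟨e₁, 0⟩).map (dotDiff k) =
      cls (0 + qdeg k) (0 + qdeg (k + 1)) circleDot +
        sign k • cls (0 + qdeg k) (0 + qdeg (k + 1)) botArc.dot₂ := fun k =>
    (map_dotDiff _ k).trans (congrArg₂ (· + sign k • ·)
      (tensorLeft_cls _ _ _ _) (tensorLeft_cls _ _ _ _))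
  have hsad : (Cob.tensorLeft ⟨e₁, 0⟩).map saddleDiff = cls (0 + 0) (0 + qdeg 0) botArc.split :=
    tensorLeft_cls _ _ _ _
  refine contractible_map (Cob.tensorLeft ⟨e₁, 0⟩) (cls (0 + qdeg 0) (0 + 0) circleDeath)
    (fun k => cls (0 + qdeg (k + 1)) (0 + qdeg k) circleSwap)
    (cls_mem_degreeZero rfl) (fun k => circleSwap_mem ?_) ?_ ?_ fun k => ?_
  · change 0 + qdeg (k + 1) = 0 + qdeg k + 2
    rw [qdeg, qdeg]; push_cast; ring
  · refine (congrArg (· ≫ _) hsad).trans ?_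
    exact (cls_comp _ _ _ _ _).trans ((botArc.cls_split_death _ _).trans (cls_nil _))
  · refine (congrArg₂ (fun (x : E (0 + qdeg 0) ⟶ E (0 + qdeg 1))
      (y : obj e₁ (0 + 0) ⟶ E (0 + qdeg 0)) =>
      x ≫ cls _ _ circleSwap + cls _ _ circleDeath ≫ y) (hdot 0) hsad).trans ?_
    refine Eq.trans ?_ (botArc.homotopy_split (0 + qdeg 0) (0 + qdeg 1) (0 + 0))
    rw [sub_eq_add_neg, ← neg_one_zsmul]
    rfl
  · refine (congrArg₂ (fun (x : E (0 + qdeg (k + 1)) ⟶ E (0 + qdeg (k + 1 + 1)))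
      (y : E (0 + qdeg k) ⟶ E (0 + qdeg (k + 1))) =>
      x ≫ cls _ _ circleSwap + cls _ _ circleSwap ≫ y) (hdot (k + 1)) (hdot k)).trans ?_
    refine Eq.trans ?_ (botArc.homotopy (0 + qdeg (k + 1)) (0 + qdeg (k + 1 + 1)) (0 + qdeg k)
      (sign (k + 1)))
    rw [sub_eq_add_neg, ← neg_smul, sign_succ k, neg_neg]
    rfl

/-- With `e₁` below, it is `b` that moves to the circle. The differential is `sign k` times `c +
sign k • x`, and the homotopies acquire the same signs. -/
theorem contractible_tensorRight :
    Contractible (tensorRight (CochainComplex.of P₂X P₂d P₂d_comp) e₁) := by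
  let E : ℤ → Cob 2 := fun q => obj (e₁.tensor e₁) q
  have hdot : ∀ k, (Cob.tensorRight ⟨e₁, 0⟩).map (dotDiff k) =
      cls (qdeg k + 0) (qdeg (k + 1) + 0) topArc.dot₂ +
        sign k • cls (qdeg k + 0) (qdeg (k + 1) + 0) circleDot := fun k =>
    (map_dotDiff _ k).trans (congrArg₂ (· + sign k • ·)
      (tensorRight_cls _ _ _ _) (tensorRight_cls _ _ _ _))
  have hsad : (Cob.tensorRight ⟨e₁, 0⟩).map saddleDiff = cls (0 + 0) (qdeg 0 + 0) topArc.split :=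
    tensorRight_cls _ _ _ _
  refine contractible_map (Cob.tensorRight ⟨e₁, 0⟩) (cls (qdeg 0 + 0) (0 + 0) circleDeath)
    (fun k => sign k • cls (qdeg (k + 1) + 0) (qdeg k + 0) circleSwap)
    (cls_mem_degreeZero rfl) (fun k => zsmul_mem (circleSwap_mem ?_) _) ?_ ?_ fun k => ?_
  · change qdeg (k + 1) + 0 = qdeg k + 0 + 2
    rw [qdeg, qdeg]; push_cast; ring
  · refine (congrArg (· ≫ _) hsad).trans ?_
    exact (cls_comp _ _ _ _ _).trans ((topArc.cls_split_death _ _).trans (cls_nil _))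
  · refine (congrArg₂ (fun (x : E (qdeg 0 + 0) ⟶ E (qdeg 1 + 0))
      (y : obj e₁ (0 + 0) ⟶ E (qdeg 0 + 0)) =>
      x ≫ (sign 0 • cls _ _ circleSwap) + cls _ _ circleDeath ≫ y) (hdot 0) hsad).trans ?_
    refine Eq.trans ?_ (topArc.homotopy_split (qdeg 0 + 0) (qdeg 1 + 0) (0 + 0))
    refine congrArg (· + _) ?_
    rw [add_zsmul_comp_zsmul (sign_mul_self 0), show sign 0 = -1 from rfl, neg_one_zsmul,
      ← sub_eq_add_neg]
  · refine (congrArg₂ (fun (x : E (qdeg (k + 1) + 0) ⟶ E (qdeg (k + 2) + 0))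
      (y : E (qdeg k + 0) ⟶ E (qdeg (k + 1) + 0)) =>
      x ≫ (sign (k + 1) • cls _ _ circleSwap) + (sign k • cls _ _ circleSwap) ≫ y)
      (hdot (k + 1)) (hdot k)).trans ?_
    refine Eq.trans ?_ (topArc.homotopy (qdeg (k + 1) + 0) (qdeg (k + 2) + 0) (qdeg k + 0)
      (sign (k + 1)))
    refine congrArg₂ (· + ·) (add_zsmul_comp_zsmul (sign_mul_self _) _ _ _) ?_
    rw [sign_succ, neg_smul, sub_neg_eq_add]
    exact zsmul_comp_add_zsmul (sign_mul_self _) _ _ _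

/-! ### The identity is not a summand of the chain groups in positive degrees -/

/-- Inclusion and projection of the summand would make the identity diagram a retract of `e₁`. All
three objects of that factorization have a single summand, so the matrix product is one composite in
`Cob 2`. -/
theorem comp_biprod_ne (q : ℤ) (D : Mat_ (Cob 2)) :
    ¬ Nonempty (shifted e₁ q ≅ shifted (one 2) 0 ⊞ D) := by
  rintro ⟨φ⟩
  have h : (biprod.inl ≫ φ.inv) ≫ (φ.hom ≫ biprod.fst) = 𝟙 (shifted (one 2) 0) := by
    simp
  have h' := congrFun (congrFun h PUnit.unit) PUnit.unit
  refine comp_ne_id 0 q ((biprod.inl ≫ φ.inv) PUnit.unit PUnit.unit)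
    ((φ.hom ≫ biprod.fst) PUnit.unit PUnit.unit) ?_
  refine Eq.trans ?_ (h'.trans (Mat_.id_apply_self _ _))
  refine Eq.trans ?_ (Mat_.comp_apply (biprod.inl ≫ φ.inv) (φ.hom ≫ biprod.fst) _ _).symm
  exact (Fintype.sum_unique (ι := PUnit) fun j =>
    (biprod.inl ≫ φ.inv) PUnit.unit j ≫ (φ.hom ≫ biprod.fst) j PUnit.unit).symm

end BarNatan

theorem theorem4p2 :
    ∃ h : ∀ k : ℤ, BarNatan.P₂d k ≫ BarNatan.P₂d (k + 1) = 0,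
      BarNatan.IsUniversalProjector (CochainComplex.of BarNatan.P₂X BarNatan.P₂d h) := by
  refine ⟨BarNatan.P₂d_comp, ?_⟩
  -- For two strands the only generator is the one with `i = 0`.
  have hgen : ∀ {i : ℕ} (h : i + 2 ≤ 2), BarNatan.e i h = BarNatan.e₁ := fun {i} h => by
    obtain rfl : i = 0 := by omega
    rfl
  constructor
  · exact ⟨0, fun k hk => BarNatan.isZero_P₂X hk⟩
  · exact fun k hk => BarNatan.isZero_P₂X hk
  · intro k hk i
    match k, hk with
    | .ofNat (k + 1), _ =>
      change (0 : ℤ) ≤ 2 * ((k : ℤ) + 1) - 1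
      omega
  · intro k
    have h : (CochainComplex.of BarNatan.P₂X BarNatan.P₂d BarNatan.P₂d_comp).d k (k + 1) =
      BarNatan.P₂d k := CochainComplex.of_d _ _ _
    rw [h]
    exact BarNatan.isDegreeZero_P₂d k
  · refine ⟨Iso.refl _, ?_⟩
    have h : BarNatan.IsDegreeZero (𝟙 (BarNatan.shifted (BarNatan.one 2) 0)) := by
      rw [BarNatan.shifted, ← (Mat_.embedding (BarNatan.Cob 2)).map_id, ← BarNatan.Cob.cls_nil]
      exact BarNatan.isDegreeZero_emb (BarNatan.cls_mem_degreeZero rfl)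
    exact ⟨h, h⟩
  · intro k hk D
    match k, hk with
    | .ofNat (k + 1), _ => exact BarNatan.comp_biprod_ne _ D
  · intro i h
    rw [hgen h]
    exact BarNatan.contractible_tensorRight
  · intro i h
    rw [hgen h]
    exact BarNatan.contractible_tensorLeft

end
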